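/- **Setting.** Terms are constants or variables; there are no function symbols and no equality. A (Boolean) CQ is a finite set of atoms, read as an existentially closed conjunction; fact bases have the same form. A UCQ is a finite set of CQs, read as their disjunction; possibly infinite sets of CQs are read likewise. A disjunctive existential rule $R = B\to H_1\vee\dots\vee H_n$ ($n\ge 1$, with $B,H_i$ non-empty finite sets of atoms) is read $\forall \vec x\,\vec y\,(B\to\bigvee_i\exists\vec z_i\,H_i)$, where $\vec z_i$ consists of the variables of $H_i$ that are not in $B$, and $\vec z_1,\dots,\vec z_n$ are pairwise disjoint. $\models$ is classical first-order entailment, and $Q_1$ is more specific than $Q_2$ if $Q_1\models Q_2$. Let $\mathcal Q$ be a UCQ and $\mathcal R$ a finite set of such rules. A *rewriting* of $\mathcal Q$ with $\mathcal R$ is a possibly infinite set $\mathcal Q'$ of CQs such that $F\models\mathcal Q'$ implies $F,\mathcal R\models\mathcal Q$ for every fact base $F$ (soundness); it is *complete* if conversely $F,\mathcal R\models\mathcal Q$ implies $F\models\mathcal Q'$ for every fact base $F$. A *UCQ-rewriting* is a finite complete rewriting, and $(\mathcal Q,\mathcal R)$ is *UCQ-rewritable* if it has one. A UCQ is *minimal*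 if it is equivalent to none of its strict subsets; a *cover* of a UCQ is a minimal subset that is equivalent to it. **Piece-unifiers.** A partition of a set of terms is *admissible* if no class contains two constants; a substitution $u$ is *associated* with it if it maps every term to a selected element of its class, the constant if there is one, and fixes the other terms. A *piece-unifier* of a CQ $Q$ with $B\to H$ (having no common variable with $Q$) is a triple $(Q',H',P)$ where $\emptyset\neq Q'\subseteq Q$, $H'\subseteq H$, and $P$ is an admissible partition of the terms of $Q'$ and $H'$ such that $u(Q')=u(H')$ for an associated $u$, and such that if a class contains a variable of $H'$ that does not occur in $B$, then all other terms of that class are variables of $Q'$ that do not occur in $Q\setminus Q'$. A *disjunctive piece-unifier* $\mu$ of $\mathcal Q$ with $R=B\to H_1\vee\dots\vee H_n$ consists of piece-unifiers $(Q_i',H_i',P_i)$ of $Q_i$ with $B\to H_i$ for $1\le i\le n$, where the $Q_i$ are copies of CQs from $\mathcal Q$ obtained by bijective variable renaming, with pairwise disjoint variables that are also disjoint from those of $R$, and the join of $P_1,\dots,P_n$ (their union, with non-disjoint classes merged until fixpoint) is admissible. Its application produces the CQ $\beta_\vee(\mathcal Q,R,\mu)=u(B)\cup\bigcup_i u(Q_i\setminus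 Q_i')$, with $u$ associated with the join. **Algorithm (breadth-first rewriting).** Initially, $\mathcal Q_{new}$ is a cover of $\mathcal Q$ and $\mathcal Q^\star=\mathcal Q_{new}$. While $\mathcal Q_{new}\ne\emptyset$: let $G$ be the finite set, up to renaming of variables, of all the CQs $\beta_\vee(\mathcal Q^\star,R,\mu)$ with $R\in\mathcal R$ and $\mu$ involving at least one CQ from $\mathcal Q_{new}$; replace $\mathcal Q_{new}$ by a cover of $G$; remove from $\mathcal Q_{new}$ the CQs more specific than some CQ of $\mathcal Q^\star$; remove from $\mathcal Q^\star$ the CQs more specific than some CQ of $\mathcal Q_{new}$; then add $\mathcal Q_{new}$ to $\mathcal Q^\star$. When the loop ends, return $\mathcal Q^\star$. **Theorem.** The algorithm can be executed on $(\mathcal Q,\mathcal R)$ and never gets stuck before halting; and, whatever covers, safe copies and associated substitutions are chosen, every execution satisfies the following, where $\mathcal Q^\star_k$ is the value of $\mathcal Q^\star$ after $k$ iterations (the last value being kept after halting). 1. It computes a sound and complete rewriting: every $\mathcal Q^\star_k$ is a (sound) rewriting of $\mathcal Q$ with $\mathcal R$; $\bigcup_k\mathcal Q^\star_k$ is a complete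 rewriting; and, for every fact base $F$ with $F,\mathcal R\models\mathcal Q$, one has $F\models\mathcal Q^\star_k$ for all sufficiently large $k$. If the execution halts, its output is a minimal UCQ-rewriting. 2. If $(\mathcal Q,\mathcal R)$ is UCQ-rewritable, then the execution halts and outputs a minimal UCQ-rewriting. -/

import Mathlib

universe u v

namespace DisjRewriting

/-- A relational vocabulary: constants, and predicates with their arities. -/
structure Vocabulary where
  Const : Type u
  Pred : Type v
  arity : Pred → ℕ

/-- Variables are taken from a fixed countably infinite set. -/
abbrev Var : Type := ℕ

inductive Term (V : Vocabulary.{u, v}) : Type u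
  | const : V.Const → Term V
  | var : Var → Term V

structure Atom (V : Vocabulary.{u, v}) : Type (max u v) where
  pred : V.Pred
  args : Fin (V.arity pred) → Term V

noncomputable instance (V : Vocabulary.{u, v}) : DecidableEq (Atom V) := Classical.decEq _

/-- A Boolean conjunctive query, seen as its finite set of atoms, all variables being
existentially quantified. Fact bases have the same form. -/
abbrev CQ (V : Vocabulary.{u, v}) := Finset (Atom V)

/-- A Boolean union of conjunctive queries: a finite set of CQs. -/
abbrev UCQ (V : Vocabulary.{u, v}) := Finset (CQ V)

variable {V : Vocabulary.{u, v}}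

def Atom.vars (a : Atom V) : Set Var := {x | ∃ j, a.args j = Term.var x}

def Atom.terms (a : Atom V) : Set (Term V) := Set.range a.args

/-- The variables occurring in a finite set of atoms. -/
def vars (S : CQ V) : Set Var := {x | ∃ a ∈ S, x ∈ a.vars}

/-- The terms occurring in a finite set of atoms. -/
def terms (S : CQ V) : Set (Term V) := {t | ∃ a ∈ S, t ∈ a.terms}

/-! ### Substitutions -/

/-- Application of a substitution of variables by terms; constants are left unchanged. -/
def Term.subst (σ : Var → Term V) : Term V → Term V
  | .const c => .const c
  | .var x => σ x

def Atom.subst (σ : Var → Term V) (a : Atom V) : Atom V :=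
  ⟨a.pred, fun j => (a.args j).subst σ⟩

noncomputable def substAtoms (σ : Var → Term V) (S : CQ V) : CQ V := S.image (Atom.subst σ)

/-- Renaming of the variables of a set of atoms by a permutation of the variables. -/
noncomputable def rename (ρ : Equiv.Perm Var) (S : CQ V) : CQ V :=
  substAtoms (fun x => Term.var (ρ x)) S

/-- Equality of CQs up to a bijective renaming of their variables. -/
def Isomorphic (Q₁ Q₂ : CQ V) : Prop := ∃ ρ : Equiv.Perm Var, rename ρ Q₁ = Q₂

/-! ### Disjunctive existential rules -/

/-- A disjunctive existential rule `B → H₁ ∨ ⋯ ∨ Hₙ`. The variables of `Hᵢ` that do not occur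
in `B` are existentially quantified in `Hᵢ`, so that they belong to no other disjunct. -/
structure Rule (V : Vocabulary.{u, v}) where
  body : Finset (Atom V)
  size : ℕ
  head : Fin size → Finset (Atom V)
  size_pos : 0 < size
  body_nonempty : body.Nonempty
  head_nonempty : ∀ i, (head i).Nonempty
  exist_disjoint : ∀ i j, i ≠ j → vars (head i) ∩ vars (head j) ⊆ vars body

def Rule.vars (R : Rule V) : Set Var :=
  DisjRewriting.vars R.body ∪ ⋃ i, DisjRewriting.vars (R.head i)

/-! ### Classical semantics -/

/-- A first-order interpretation of the vocabulary. -/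
structure Interpretation (V : Vocabulary.{u, v}) where
  Dom : Type u
  nonempty : Nonempty Dom
  const : V.Const → Dom
  rel : (p : V.Pred) → (Fin (V.arity p) → Dom) → Prop

namespace Interpretation

def eval (I : Interpretation V) (e : Var → I.Dom) : Term V → I.Dom
  | .const c => I.const c
  | .var x => e x

def Holds (I : Interpretation V) (e : Var → I.Dom) (a : Atom V) : Prop :=
  I.rel a.pred fun j => I.eval e (a.args j)

/-- `I` satisfies the existential closure of the conjunction of the atoms of `S`. -/
def ModelsCQ (I : Interpretation V) (S : CQ V) : Prop :=
  ∃ e : Var → I.Dom, ∀ a ∈ S, I.Holds e a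

/-- `I` satisfies the (possibly infinite) disjunction of the CQs of `A`. -/
def ModelsUnion (I : Interpretation V) (A : Set (CQ V)) : Prop := ∃ Q ∈ A, I.ModelsCQ Q

def ModelsRule (I : Interpretation V) (R : Rule V) : Prop :=
  ∀ e : Var → I.Dom, (∀ a ∈ R.body, I.Holds e a) →
    ∃ i, ∃ e' : Var → I.Dom, (∀ x ∈ vars R.body, e' x = e x) ∧ ∀ a ∈ R.head i, I.Holds e' a

end Interpretation

/-- `A ⊨ B` for possibly infinite disjunctions of CQs. -/
def Entails (A B : Set (CQ V)) : Prop :=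
  ∀ I : Interpretation V, I.ModelsUnion A → I.ModelsUnion B

def Equivalent (A B : Set (CQ V)) : Prop := Entails A B ∧ Entails B A

/-- `F ⊨ A` for a fact base `F` and a possibly infinite disjunction `A` of CQs. -/
def FactsEntail (F : CQ V) (A : Set (CQ V)) : Prop :=
  ∀ I : Interpretation V, I.ModelsCQ F → I.ModelsUnion A

/-- `F, ℛ ⊨ 𝒬` for a knowledge base `(F, ℛ)` and a UCQ `𝒬`. -/
def KBEntails (F : CQ V) (ℛ : Finset (Rule V)) (𝒬 : UCQ V) : Prop :=
  ∀ I : Interpretation V, I.ModelsCQ F → (∀ R ∈ ℛ, I.ModelsRule R) → I.ModelsUnion (𝒬 : Set (CQ V))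

/-! ### Rewritings -/

/-- A (sound) rewriting of `𝒬` with `ℛ`: a possibly infinite set of CQs. -/
def IsRewriting (𝒬 : UCQ V) (ℛ : Finset (Rule V)) (A : Set (CQ V)) : Prop :=
  ∀ F : CQ V, FactsEntail F A → KBEntails F ℛ 𝒬

/-- A sound and complete rewriting. -/
def IsCompleteRewriting (𝒬 : UCQ V) (ℛ : Finset (Rule V)) (A : Set (CQ V)) : Prop :=
  IsRewriting 𝒬 ℛ A ∧ ∀ F : CQ V, KBEntails F ℛ 𝒬 → FactsEntail F A

/-- A UCQ-rewriting is a finite complete rewriting. -/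
def IsUCQRewriting (𝒬 : UCQ V) (ℛ : Finset (Rule V)) (A : UCQ V) : Prop :=
  IsCompleteRewriting 𝒬 ℛ (A : Set (CQ V))

def UCQRewritable (𝒬 : UCQ V) (ℛ : Finset (Rule V)) : Prop := ∃ A : UCQ V, IsUCQRewriting 𝒬 ℛ A

/-- A UCQ is minimal if it is equivalent to none of its strict subsets. -/
def IsMinimal (A : UCQ V) : Prop :=
  ∀ A' : UCQ V, A' ⊂ A → ¬ Equivalent (A : Set (CQ V)) (A' : Set (CQ V))

/-- `K` is a cover of `A`: a minimal subset of `A` that is equivalent to `A`. -/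
def IsCover (A K : UCQ V) : Prop :=
  K ⊆ A ∧ Equivalent (A : Set (CQ V)) (K : Set (CQ V)) ∧ IsMinimal K

/-! ### Piece-unifiers

A partition of a set `T` of terms is represented by the equivalence relation on all terms whose
classes are those of the partition, together with the singletons `{t}` for `t ∉ T`. The join of
partitions (union, then merging of non-disjoint classes until a fixed point) is then the
supremum of equivalence relations. -/

/-- `P` represents a partition of `T`. -/
def IsPartitionOn (P : Setoid (Term V)) (T : Set (Term V)) : Prop :=
  ∀ s t, P s t → s = t ∨ (s ∈ T ∧ t ∈ T)

/-- No class contains two distinct constants. -/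
def Admissible (P : Setoid (Term V)) : Prop :=
  ∀ c d : V.Const, P (Term.const c) (Term.const d) → c = d

/-- `σ` replaces every term by an element selected in its class. Since substitutions leave
constants unchanged, the selected element is the constant of the class if there is one. -/
def IsAssociated (P : Setoid (Term V)) (σ : Var → Term V) : Prop :=
  (∀ x, P (Term.var x) (σ x)) ∧ ∀ s t, P s t → s.subst σ = t.subst σ

/-- `(Q', H', P)` is a piece-unifier of the CQ `Q` with the conjunctive rule `B → H`. -/
structure IsPieceUnifier (Q B H Q' H' : CQ V) (P : Setoid (Term V)) : Prop where
  disjoint_rule : Disjoint (vars Q) (vars B ∪ vars H)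
  nonempty : Q'.Nonempty
  subset_query : Q' ⊆ Q
  subset_head : H' ⊆ H
  partition : IsPartitionOn P (terms Q' ∪ terms H')
  admissible : Admissible P
  unifies : ∃ σ, IsAssociated P σ ∧ substAtoms σ Q' = substAtoms σ H'
  /-- a class with an existential variable otherwise has only non-separating variables of `Q'` -/
  existential : ∀ z ∈ vars H' \ vars B, ∀ t, P (Term.var z) t → t ≠ Term.var z →
    ∃ x ∈ vars Q' \ vars (Q \ Q'), t = Term.var x

/-- A disjunctive piece-unifier of a set `A` of CQs with the rule `R`: each disjunct `Hᵢ` of the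
head is unified with a safe copy `Qᵢ` of a CQ of `A`. -/
structure DisjPieceUnifier (A : UCQ V) (R : Rule V) where
  /-- the CQs of `A` that are involved -/
  source : Fin R.size → CQ V
  source_mem : ∀ i, source i ∈ A
  /-- the renamings that yield the safe copies -/
  ren : Fin R.size → Equiv.Perm Var
  disjoint_rule : ∀ i, Disjoint (vars (rename (ren i) (source i))) R.vars
  disjoint_copies : ∀ i j, i ≠ j →
    Disjoint (vars (rename (ren i) (source i))) (vars (rename (ren j) (source j)))
  /-- the unified subset `Qᵢ'` of `Qᵢ` -/
  queryPart : Fin R.size → CQ V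
  /-- the unified subset `Hᵢ'` of `Hᵢ` -/
  headPart : Fin R.size → CQ V
  partition : Fin R.size → Setoid (Term V)
  isPieceUnifier : ∀ i, IsPieceUnifier (rename (ren i) (source i)) R.body (R.head i)
    (queryPart i) (headPart i) (partition i)
  admissible : Admissible (⨆ i, partition i)

namespace DisjPieceUnifier

variable {A : UCQ V} {R : Rule V}

def join (μ : DisjPieceUnifier A R) : Setoid (Term V) := ⨆ i, μ.partition i

/-- The safe copy `Qᵢ`. -/
noncomputable def copy (μ : DisjPieceUnifier A R) (i : Fin R.size) : CQ V :=
  rename (μ.ren i) (μ.source i)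

/-- The CQ `σ(B) ∪ ⋃ᵢ σ(Qᵢ \ Qᵢ')`. -/
noncomputable def apply (μ : DisjPieceUnifier A R) (σ : Var → Term V) : CQ V :=
  substAtoms σ R.body ∪
    Finset.univ.biUnion fun i => substAtoms σ (μ.copy i \ μ.queryPart i)

/-- `Q` is produced by the application of `μ`, for some associated substitution. -/
def Produces (μ : DisjPieceUnifier A R) (Q : CQ V) : Prop :=
  ∃ σ, IsAssociated μ.join σ ∧ Q = μ.apply σ

/-- `μ` is new: it involves at least one CQ generated at the previous step. -/
def IsNew (μ : DisjPieceUnifier A R) (prev : UCQ V) : Prop := ∃ i, μ.source i ∈ prev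

end DisjPieceUnifier

/-! ### The breadth-first rewriting algorithm -/

/-- `Q` is produced from `star` by a new disjunctive piece-unifier with a rule of `ℛ`. -/
def NewlyProduced (star prev : UCQ V) (ℛ : Finset (Rule V)) (Q : CQ V) : Prop :=
  ∃ R ∈ ℛ, ∃ μ : DisjPieceUnifier star R, μ.IsNew prev ∧ μ.Produces Q

/-- `G` is a possible output of `generate(star, prev, ℛ)`: a finite set of CQs produced by new
disjunctive piece-unifiers, that contains all of them up to the names of the variables (the
names given in safe copies and the selected elements of classes are arbitrary). -/
def IsGenerated (star prev : UCQ V) (ℛ : Finset (Rule V)) (G : UCQ V) : Prop :=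
  (∀ Q ∈ G, NewlyProduced star prev ℛ Q) ∧
    ∀ Q, NewlyProduced star prev ℛ Q → ∃ Q' ∈ G, Isomorphic Q' Q

open Classical in
/-- `A` minus its queries that are more specific than a query of `B`. -/
noncomputable def removeMoreSpecific (A B : UCQ V) : UCQ V :=
  A.filter fun Q => ¬ ∃ Q' ∈ B, Entails {Q} {Q'}

/-- The values of the two variables of the algorithm that persist between two iterations. -/
structure State (V : Vocabulary.{u, v}) where
  /-- the rewriting under construction -/
  star : UCQ V
  /-- the CQs generated at the last step -/
  new : UCQ V

/-- Initialization, before the loop. -/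
def IsInitial (𝒬 : UCQ V) (s : State V) : Prop := IsCover 𝒬 s.new ∧ s.star = s.new

/-- The loop has been left (or is not entered), and `s.star` is returned. -/
def State.Halted (s : State V) : Prop := s.new = ∅

/-- One iteration of the loop. -/
def Step (ℛ : Finset (Rule V)) (s s' : State V) : Prop :=
  ¬ s.Halted ∧ ∃ G K : UCQ V, IsGenerated s.star s.new ℛ G ∧ IsCover G K ∧
    s'.new = removeMoreSpecific K s.star ∧
    s'.star = removeMoreSpecific s.star s'.new ∪ s'.new

/-- `s` is an execution on `(𝒬, ℛ)`; after halting, the last state is repeated forever. -/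
def IsRun (𝒬 : UCQ V) (ℛ : Finset (Rule V)) (s : ℕ → State V) : Prop :=
  IsInitial 𝒬 (s 0) ∧ ∀ n, Step ℛ (s n) (s (n + 1)) ∨ ((s n).Halted ∧ s (n + 1) = s n)

end DisjRewriting

open DisjRewriting

/-! Without functions and equality, a fact base entails a union of CQs iff one of them maps to it
homomorphically (`factsEntail_iff`).

Soundness of a step: in a model of the rule and of the produced CQ, the body matches, so some
disjunct of the head holds, and the query unified with that disjunct holds too
(`DisjPieceUnifier.Produces.modelsUnion`).

Completeness goes by contradiction. Call a fact base bad if no `A n` covers it. When a rule is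
triggered on a bad `F`, adding one of the disjuncts keeps it bad: otherwise queries of a common `A
n` map to all the extensions but not to `F`, these homomorphisms define a disjunctive piece-unifier,
and the produced CQ maps to `F` (`exists_produces_homTo`), although `A (n + 1)` covers that CQ.
Iterating fairly builds one infinite branch of the disjunctive chase; its union is a model of the
rules and of `F`, but not of `𝒬` (`exists_factsEntail_of_kbEntails`).

The algorithm fits this scheme: `star` only grows for entailment, and unifiers with old queries
alone were treated earlier (`IsRun.factsEntail_of_produces`). As the argument only uses queries
present in the current `star`, removals do no harm. If a finite rewriting exists, some `star` covers
it; any later new CQ is sound, hence more specific than a CQ of `star`, and would have been removed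
(`IsRun.exists_halted`). -/

namespace DisjRewriting

variable {V : Vocabulary.{u, v}}

/-! ### Substitutions -/

theorem Term.subst_subst (σ τ : Var → Term V) (t : Term V) :
    (t.subst τ).subst σ = t.subst fun x => (τ x).subst σ := by
  cases t <;> rfl

theorem Term.subst_var (t : Term V) : t.subst Term.var = t := by
  cases t <;> rfl

theorem Atom.subst_subst (σ τ : Var → Term V) (a : Atom V) :
    (a.subst τ).subst σ = a.subst fun x => (τ x).subst σ := by
  simp [Atom.subst, Term.subst_subst]

theorem Atom.subst_var (a : Atom V) : a.subst Term.var = a := by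
  simp [Atom.subst, Term.subst_var]

theorem Atom.subst_congr {σ τ : Var → Term V} {a : Atom V} (h : ∀ x ∈ a.vars, σ x = τ x) :
    a.subst σ = a.subst τ := by
  unfold Atom.subst
  congr 1
  funext j
  cases hj : a.args j with
  | const c => rfl
  | var x => exact h x ⟨j, hj⟩

/-- If two atoms have the same image under `σ` and `τ`, they have the same image under any
substitutions that identify the terms identified by `σ` and `τ`. -/
theorem Atom.subst_eq_subst_of_imp {σ τ σ' τ' : Var → Term V} {a b : Atom V}
    (h : a.subst σ = b.subst τ)
    (hi : ∀ s ∈ a.terms, ∀ t ∈ b.terms, s.subst σ = t.subst τ → s.subst σ' = t.subst τ') :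
    a.subst σ' = b.subst τ' := by
  obtain ⟨p, f⟩ := a
  obtain ⟨q, g⟩ := b
  simp only [Atom.subst, Atom.mk.injEq] at h
  obtain ⟨rfl, h⟩ := h
  have h := congrFun (eq_of_heq h)
  simp only [Atom.subst, Atom.mk.injEq, heq_eq_eq, true_and]
  funext j
  exact hi _ ⟨j, rfl⟩ _ ⟨j, rfl⟩ (h j)

theorem mem_substAtoms {σ : Var → Term V} {S : CQ V} {a : Atom V} :
    a ∈ substAtoms σ S ↔ ∃ b ∈ S, b.subst σ = a := by
  simp [substAtoms]

theorem substAtoms_substAtoms (σ τ : Var → Term V) (S : CQ V) :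
    substAtoms σ (substAtoms τ S) = substAtoms (fun x => (τ x).subst σ) S := by
  ext a
  simp [mem_substAtoms, Atom.subst_subst]

theorem substAtoms_var (S : CQ V) : substAtoms Term.var S = S := by
  ext a
  simp [mem_substAtoms, Atom.subst_var]

theorem substAtoms_congr {σ τ : Var → Term V} {S : CQ V} (h : ∀ x ∈ vars S, σ x = τ x) :
    substAtoms σ S = substAtoms τ S :=
  Finset.image_congr fun a ha => Atom.subst_congr fun x hx => h x ⟨a, ha, hx⟩

theorem substAtoms_mono (σ : Var → Term V) {S T : CQ V} (h : S ⊆ T) :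
    substAtoms σ S ⊆ substAtoms σ T :=
  Finset.image_subset_image h

theorem mem_vars_iff {S : CQ V} {x : Var} : x ∈ vars S ↔ Term.var x ∈ terms S := Iff.rfl

theorem terms_mono {S T : CQ V} (h : S ⊆ T) : terms S ⊆ terms T :=
  fun _ ⟨a, ha, ht⟩ => ⟨a, h ha, ht⟩

theorem vars_mono {S T : CQ V} (h : S ⊆ T) : vars S ⊆ vars T :=
  fun _ ⟨a, ha, ht⟩ => ⟨a, h ha, ht⟩

theorem terms_substAtoms (σ : Var → Term V) (S : CQ V) :
    terms (substAtoms σ S) = (Term.subst σ) '' terms S := by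
  ext t
  constructor
  · rintro ⟨a, ha, j, rfl⟩
    obtain ⟨b, hb, rfl⟩ := mem_substAtoms.1 ha
    exact ⟨b.args j, ⟨b, hb, j, rfl⟩, rfl⟩
  · rintro ⟨_, ⟨b, hb, j, rfl⟩, rfl⟩
    exact ⟨b.subst σ, mem_substAtoms.2 ⟨b, hb, rfl⟩, j, rfl⟩

theorem vars_rename (ρ : Equiv.Perm Var) (S : CQ V) : vars (rename ρ S) = ρ '' vars S := by
  ext x
  rw [mem_vars_iff, rename, terms_substAtoms]
  constructor
  · rintro ⟨t, ht, h⟩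
    cases t with
    | const c => cases h
    | var y =>
      injection h with h
      exact ⟨y, ht, h⟩
  · rintro ⟨y, hy, rfl⟩
    exact ⟨_, hy, rfl⟩

theorem finite_terms (S : CQ V) : (terms S).Finite := by
  have : terms S = ⋃ a ∈ S, Set.range a.args := by
    ext t
    simp [terms, Atom.terms]
  rw [this]
  exact S.finite_toSet.biUnion fun a _ => Set.finite_range _

theorem finite_vars (S : CQ V) : (vars S).Finite :=
  (finite_terms S).preimage (f := Term.var) fun _ _ _ _ h => by injection h

theorem exists_vars_lt (S : CQ V) : ∃ N, ∀ x ∈ vars S, x < N := by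
  obtain ⟨N, hN⟩ := (finite_vars S).bddAbove
  exact ⟨N + 1, fun x hx => Nat.lt_succ_of_le (hN hx)⟩

theorem Rule.finite_vars (R : Rule V) : R.vars.Finite :=
  (DisjRewriting.finite_vars _).union (Set.finite_iUnion fun _ => DisjRewriting.finite_vars _)

/-! ### Isomorphism -/

theorem Isomorphic.symm {Q₁ Q₂ : CQ V} : Isomorphic Q₁ Q₂ → Isomorphic Q₂ Q₁ := by
  rintro ⟨ρ, rfl⟩
  refine ⟨ρ.symm, ?_⟩
  simp only [rename, substAtoms_substAtoms, Term.subst, Equiv.symm_apply_apply]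
  exact substAtoms_var _

theorem Isomorphic.trans {Q₁ Q₂ Q₃ : CQ V} :
    Isomorphic Q₁ Q₂ → Isomorphic Q₂ Q₃ → Isomorphic Q₁ Q₃ := by
  rintro ⟨ρ, rfl⟩ ⟨τ, rfl⟩
  refine ⟨ρ.trans τ, ?_⟩
  simp [rename, substAtoms_substAtoms, Term.subst]

/-! ### Homomorphisms and entailment -/

namespace Interpretation

theorem eval_subst (I : Interpretation V) (e : Var → I.Dom) (σ : Var → Term V) (t : Term V) :
    I.eval e (t.subst σ) = I.eval (fun x => I.eval e (σ x)) t := by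
  cases t <;> rfl

theorem holds_subst (I : Interpretation V) (e : Var → I.Dom) (σ : Var → Term V) (a : Atom V) :
    I.Holds e (a.subst σ) ↔ I.Holds (fun x => I.eval e (σ x)) a := by
  simp [Holds, Atom.subst, eval_subst]

/-- The interpretation on terms whose true atoms are those of `S`. -/
def canonical (S : Set (Atom V)) : Interpretation V where
  Dom := Term V
  nonempty := ⟨Term.var 0⟩
  const := Term.const
  rel p f := ⟨p, f⟩ ∈ S

theorem canonical_holds (S : Set (Atom V)) (e : Var → Term V) (a : Atom V) :
    (canonical S).Holds e a ↔ a.subst e ∈ S := by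
  have : (fun j => (canonical S).eval e (a.args j)) = fun j => (a.args j).subst e := by
    funext j
    cases a.args j <;> rfl
  unfold Holds
  rw [this]
  rfl

end Interpretation

/-- There is a homomorphism from `Q` to `F`. -/
def HomTo (Q F : CQ V) : Prop := ∃ g : Var → Term V, substAtoms g Q ⊆ F

theorem HomTo.refl (Q : CQ V) : HomTo Q Q := ⟨Term.var, (substAtoms_var Q).subset⟩

theorem HomTo.trans {Q₁ Q₂ Q₃ : CQ V} : HomTo Q₁ Q₂ → HomTo Q₂ Q₃ → HomTo Q₁ Q₃ := by
  rintro ⟨f, hf⟩ ⟨g, hg⟩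
  refine ⟨fun x => (f x).subst g, ?_⟩
  rw [← substAtoms_substAtoms]
  exact (substAtoms_mono g hf).trans hg

theorem Isomorphic.homTo {Q₁ Q₂ : CQ V} : Isomorphic Q₁ Q₂ → HomTo Q₁ Q₂ :=
  fun ⟨_, h⟩ => ⟨_, h.subset⟩

theorem HomTo.modelsCQ {Q F : CQ V} (h : HomTo Q F) {I : Interpretation V}
    (hI : I.ModelsCQ F) : I.ModelsCQ Q := by
  obtain ⟨g, hg⟩ := h
  obtain ⟨e, he⟩ := hI
  exact ⟨_, fun a ha => (I.holds_subst e g a).1 (he _ (hg (mem_substAtoms.2 ⟨a, ha, rfl⟩)))⟩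

/-- Valuations in the canonical model of `F` are substitutions, and the identity makes it a model of
`F`. This single model decides entailment, so `A` may be infinite. -/
theorem factsEntail_iff {F : CQ V} {A : Set (CQ V)} :
    FactsEntail F A ↔ ∃ Q ∈ A, HomTo Q F := by
  constructor
  · intro h
    obtain ⟨Q, hQ, e, he⟩ := h (.canonical F)
      ⟨Term.var, fun a ha => (Interpretation.canonical_holds _ _ _).2 (by rwa [Atom.subst_var])⟩
    refine ⟨Q, hQ, e, fun a ha => ?_⟩
    obtain ⟨b, hb, rfl⟩ := mem_substAtoms.1 ha
    exact (Interpretation.canonical_holds _ _ _).1 (he b hb)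
  · rintro ⟨Q, hQ, h⟩ I hI
    exact ⟨Q, hQ, h.modelsCQ hI⟩

theorem entails_iff_factsEntail {A B : Set (CQ V)} :
    Entails A B ↔ ∀ Q ∈ A, FactsEntail Q B :=
  ⟨fun h Q hQ I hI => h I ⟨Q, hQ, hI⟩, fun h I ⟨Q, hQ, hI⟩ => h Q hQ I hI⟩

theorem entails_iff {A B : Set (CQ V)} : Entails A B ↔ ∀ Q ∈ A, ∃ Q' ∈ B, HomTo Q' Q := by
  simp only [entails_iff_factsEntail, factsEntail_iff]

theorem entails_singleton {Q Q' : CQ V} : Entails {Q} {Q'} ↔ HomTo Q' Q := by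
  simp [entails_iff]

theorem Entails.refl (A : Set (CQ V)) : Entails A A := fun _ h => h

theorem Entails.trans {A B C : Set (CQ V)} (h : Entails A B) (h' : Entails B C) : Entails A C :=
  fun I hI => h' I (h I hI)

theorem FactsEntail.trans {F : CQ V} {A B : Set (CQ V)} (h : FactsEntail F A)
    (h' : Entails A B) : FactsEntail F B :=
  fun I hI => h' I (h I hI)

theorem FactsEntail.of_homTo {Q F : CQ V} {A : Set (CQ V)} (h : HomTo Q F)
    (h' : FactsEntail Q A) : FactsEntail F A :=
  fun I hI => h' I (h.modelsCQ hI)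

/-! ### Soundness of a rewriting step -/

namespace Interpretation

theorem holds_congr {I : Interpretation V} {e e' : Var → I.Dom} {a : Atom V}
    (h : ∀ x ∈ a.vars, e x = e' x) : I.Holds e a ↔ I.Holds e' a := by
  have : (fun j => I.eval e (a.args j)) = fun j => I.eval e' (a.args j) := by
    funext j
    cases hj : a.args j with
    | const c => rfl
    | var x => exact h x ⟨j, hj⟩
  simp [Holds, this]

theorem holds_iff_of_subst_eq {I : Interpretation V} {e e' : Var → I.Dom} {σ τ : Var → Term V}
    {a b : Atom V} (h : a.subst σ = b.subst τ)
    (hi : ∀ s ∈ a.terms, ∀ t ∈ b.terms, s.subst σ = t.subst τ → I.eval e s = I.eval e' t) :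
    I.Holds e a ↔ I.Holds e' b := by
  obtain ⟨p, f⟩ := a
  obtain ⟨q, g⟩ := b
  simp only [Atom.subst, Atom.mk.injEq] at h
  obtain ⟨rfl, h⟩ := h
  have h := congrFun (eq_of_heq h)
  have : (fun j => I.eval e (f j)) = fun j => I.eval e' (g j) := by
    funext j
    exact hi _ ⟨j, rfl⟩ _ ⟨j, rfl⟩ (h j)
  simp [Holds, this]

end Interpretation

theorem IsAssociated.rel_subst {P : Setoid (Term V)} {σ : Var → Term V} (h : IsAssociated P σ)
    (t : Term V) : P t (t.subst σ) := by
  cases t with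
  | const c => exact P.refl _
  | var x => exact h.1 x

/-- Each term is related to its image. With the second clause of `IsAssociated`, the kernel of `σ`
is therefore exactly `P`. -/
theorem IsAssociated.rel_of_subst_eq {P : Setoid (Term V)} {σ : Var → Term V}
    (h : IsAssociated P σ) {s t : Term V} (hst : s.subst σ = t.subst σ) : P s t :=
  P.trans (h.rel_subst s) (hst ▸ P.symm (h.rel_subst t))

theorem homTo_rename (ρ : Equiv.Perm Var) (S : CQ V) : HomTo S (rename ρ S) :=
  Isomorphic.homTo ⟨ρ, rfl⟩

/-- A model of the application of a substitution `σ`, in which the head `H` of the rule holds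
through `e'`, is a model of the query unified with `H`. -/
theorem IsPieceUnifier.modelsCQ {Q B H Q' H' : CQ V} {P : Setoid (Term V)}
    (U : IsPieceUnifier Q B H Q' H' P) {σ : Var → Term V}
    (hσ : ∀ s t, P s t → s.subst σ = t.subst σ) {I : Interpretation V} {e e' : Var → I.Dom}
    (hQ : ∀ a ∈ Q \ Q', I.Holds e (a.subst σ))
    (he : ∀ x ∈ vars B, e' x = I.eval e (σ x)) (hH : ∀ a ∈ H, I.Holds e' a) :
    I.ModelsCQ Q := by
  classical
  have disj : ∀ x ∈ vars Q, x ∈ vars B ∪ vars H → False := fun x h h' =>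
    Set.disjoint_left.1 U.disjoint_rule h h'
  -- Query variables glued to an existential variable take the witness given by `e'`; all others are
  -- read through `σ`.
  let f : Var → I.Dom := fun x =>
    if h : ∃ z ∈ vars H' \ vars B, P (Term.var z) (Term.var x) then e' h.choose
    else I.eval e (σ x)
  have hf : ∀ s, (∀ z ∈ vars H' \ vars B, ¬ P (Term.var z) s) →
      I.eval f s = I.eval e (s.subst σ) := by
    intro s hs
    cases s with
    | const c => rfl
    | var x =>
      simp only [Interpretation.eval, f]
      rw [dif_neg fun ⟨z, hz, h⟩ => hs z hz h]
      rfl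
  refine ⟨f, fun a ha => ?_⟩
  by_cases ha' : a ∈ Q'
  · obtain ⟨τ, hτ, heq⟩ := U.unifies
    have hmem : a.subst τ ∈ substAtoms τ H' := heq ▸ mem_substAtoms.2 ⟨a, ha', rfl⟩
    obtain ⟨b, hb, hab⟩ := mem_substAtoms.1 hmem
    refine (Interpretation.holds_iff_of_subst_eq hab.symm ?_).2 (hH b (U.subset_head hb))
    intro s hs t ht hst
    have hP : P s t := hτ.rel_of_subst_eq hst
    by_cases hz : ∃ z ∈ vars H' \ vars B, P (Term.var z) s
    · obtain ⟨z, hz, hzs⟩ := hz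
      -- The class of `z` otherwise contains only query variables, which a term of the head cannot
      -- be. So the `z` chosen in `f` is `t` itself.
      have key : ∀ z ∈ vars H' \ vars B, P (Term.var z) s → t = Term.var z := by
        intro z hz hzs
        by_contra hne
        obtain ⟨x, hx, rfl⟩ := U.existential z hz t (P.trans hzs hP) hne
        exact disj x (vars_mono U.subset_query hx.1) (Or.inr ⟨b, U.subset_head hb, ht⟩)
      have hs' : s ≠ Term.var z := by
        rintro rfl
        exact disj z ⟨a, ha, hs⟩ (Or.inr (vars_mono U.subset_head hz.1))
      obtain ⟨x, hx, rfl⟩ := U.existential z hz s hzs hs'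
      have hex : ∃ z ∈ vars H' \ vars B, P (Term.var z) (Term.var x) := ⟨z, hz, hzs⟩
      have ht' := key _ hex.choose_spec.1 hex.choose_spec.2
      rw [ht']
      simp only [Interpretation.eval, f]
      rw [dif_pos hex]
    · push Not at hz
      rw [hf s hz, hσ s t hP]
      cases t with
      | const c => rfl
      | var y =>
        refine (he y ?_).symm
        by_contra hy
        exact hz y ⟨⟨b, hb, ht⟩, hy⟩ (P.symm hP)
  -- A variable of an atom outside `Q'` is separating, hence in no class of an existential variable,
  -- and `f` agrees with `e` after `σ` on it.
  · have ha'' : a ∈ Q \ Q' := Finset.mem_sdiff.2 ⟨ha, ha'⟩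
    refine (Interpretation.holds_congr fun x hx => ?_).1 ((I.holds_subst e σ a).1 (hQ a ha''))
    refine (hf (Term.var x) fun z hz hzx => ?_).symm
    by_cases hne : (Term.var x : Term V) = Term.var z
    · injection hne with hne
      subst hne
      exact disj x ⟨a, ha, hx⟩ (Or.inr (vars_mono U.subset_head hz.1))
    · obtain ⟨y, hy, h⟩ := U.existential z hz _ hzx hne
      injection h with h
      subst h
      exact hy.2 ⟨a, ha'', hx⟩

theorem DisjPieceUnifier.Produces.modelsUnion {A : UCQ V} {R : Rule V}
    {μ : DisjPieceUnifier A R} {Q : CQ V} (h : μ.Produces Q) {I : Interpretation V}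
    (hI : I.ModelsCQ Q) (hR : I.ModelsRule R) : I.ModelsUnion (A : Set (CQ V)) := by
  obtain ⟨σ, hσ, rfl⟩ := h
  obtain ⟨e, he⟩ := hI
  obtain ⟨i, e', he', hH⟩ := hR (fun x => I.eval e (σ x)) fun a ha =>
    (I.holds_subst e σ a).1 (he _ (Finset.mem_union_left _ (mem_substAtoms.2 ⟨a, ha, rfl⟩)))
  refine ⟨μ.source i, μ.source_mem i, (homTo_rename (μ.ren i) _).modelsCQ ?_⟩
  refine (μ.isPieceUnifier i).modelsCQ (fun s t hst => hσ.2 s t ?_) (fun a ha => he _ ?_) he' hH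
  · exact le_iSup μ.partition i hst
  · exact Finset.mem_union_right _ (Finset.mem_biUnion.2
      ⟨i, Finset.mem_univ _, mem_substAtoms.2 ⟨a, ha, rfl⟩⟩)

/-! ### Completeness of a rewriting step -/

/-- A representative is selected in each class; admissibility lets it be the constant of the class,
if any. -/
theorem Admissible.exists_isAssociated {P : Setoid (Term V)} (hP : Admissible P) :
    ∃ σ, IsAssociated P σ := by
  have : ∀ q : Quotient P, ∃ t : Term V, Quotient.mk P t = q ∧
      ∀ c, Quotient.mk P (Term.const c) = q → t = Term.const c := by
    intro q
    by_cases hc : ∃ c, Quotient.mk P (Term.const c) = q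
    · obtain ⟨c, hc⟩ := hc
      refine ⟨Term.const c, hc, fun d hd => ?_⟩
      rw [hP c d (Quotient.exact (hc.trans hd.symm))]
    · exact ⟨q.out, q.out_eq, fun c h => (hc ⟨c, h⟩).elim⟩
  choose rep hrep hconst using this
  have hs : ∀ t : Term V, t.subst (fun x => rep (Quotient.mk P (Term.var x))) =
      rep (Quotient.mk P t) := by
    intro t
    cases t with
    | const c => exact (hconst _ c rfl).symm
    | var x => rfl
  refine ⟨_, fun x => Quotient.exact (hrep _).symm, fun s t hst => ?_⟩
  rw [hs, hs, Quotient.sound (s := P) hst]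

/-- The equivalence relation that identifies the terms of `T` having the same image under `G`. -/
def kernelOn (G : Var → Term V) (T : Set (Term V)) : Setoid (Term V) where
  r s t := s = t ∨ (s ∈ T ∧ t ∈ T ∧ s.subst G = t.subst G)
  iseqv :=
    { refl := fun _ => Or.inl rfl
      symm := by
        rintro s t (rfl | ⟨h, h', e⟩)
        · exact Or.inl rfl
        · exact Or.inr ⟨h', h, e.symm⟩
      trans := by
        rintro r s t (rfl | ⟨h, h', e⟩) (rfl | ⟨k, k', e'⟩)
        · exact Or.inl rfl
        · exact Or.inr ⟨k, k', e'⟩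
        · exact Or.inr ⟨h, h', e⟩
        · exact Or.inr ⟨h, k', e.trans e'⟩ }

theorem kernelOn_apply {G : Var → Term V} {T : Set (Term V)} {s t : Term V} :
    kernelOn G T s t ↔ s = t ∨ (s ∈ T ∧ t ∈ T ∧ s.subst G = t.subst G) := Iff.rfl

/-- The equivalence relation that identifies the terms having the same image under `G`. -/
def kernel (G : Var → Term V) : Setoid (Term V) := Setoid.ker (Term.subst G)

theorem kernel_apply {G : Var → Term V} {s t : Term V} :
    kernel G s t ↔ s.subst G = t.subst G := Iff.rfl

theorem kernelOn_le (G : Var → Term V) (T : Set (Term V)) : kernelOn G T ≤ kernel G := by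
  intro s t h
  rcases kernelOn_apply.1 h with rfl | h
  · exact (kernel G).refl s
  · exact h.2.2

/-- Substitutions fix constants, so a kernel never identifies two of them. This serves for the
single partitions and for their join. -/
theorem admissible_of_le_kernel {P : Setoid (Term V)} {G : Var → Term V} (h : P ≤ kernel G) :
    Admissible P := by
  intro c d hcd
  have := kernel_apply.1 (h hcd)
  injection this

/-- A homomorphism `G` from the query `Q` to the instance `F` extended with the image of the head
`H`, where existential variables are mapped injectively to fresh variables, yields a
piece-unifier if it does not map `Q` to `F`. -/
theorem isPieceUnifier_of_hom {Q B H F : CQ V} {G : Var → Term V}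
    (hdisj : Disjoint (vars Q) (vars B ∪ vars H))
    (hQ : substAtoms G Q ⊆ F ∪ substAtoms G H) (hnot : ¬ substAtoms G Q ⊆ F)
    (hB : substAtoms G B ⊆ F)
    (hfresh : ∀ z ∈ vars H \ vars B, ∃ w, G z = Term.var w ∧ w ∉ vars F)
    (hinj : ∀ z ∈ vars H \ vars B, ∀ y ∈ vars H \ vars B, G z = G y → z = y)
    {Q' H' : CQ V} (hQ' : ∀ a, a ∈ Q' ↔ a ∈ Q ∧ a.subst G ∉ F)
    (hH' : ∀ b, b ∈ H' ↔ b ∈ H ∧ ∃ a ∈ Q', a.subst G = b.subst G) :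
    IsPieceUnifier Q B H Q' H' (kernelOn G (terms Q' ∪ terms H')) where
  disjoint_rule := hdisj
  nonempty := by
    obtain ⟨b, hb, hbF⟩ := Finset.not_subset.1 hnot
    obtain ⟨a, ha, rfl⟩ := mem_substAtoms.1 hb
    exact ⟨a, (hQ' a).2 ⟨ha, hbF⟩⟩
  subset_query := fun a ha => ((hQ' a).1 ha).1
  subset_head := fun a ha => ((hH' a).1 ha).1
  partition := by
    intro s t h
    rcases kernelOn_apply.1 h with h | h
    · exact Or.inl h
    · exact Or.inr ⟨h.1, h.2.1⟩
  admissible := admissible_of_le_kernel (kernelOn_le _ _)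
  unifies := by
    obtain ⟨σ, hσ⟩ := (admissible_of_le_kernel
      (kernelOn_le G (terms Q' ∪ terms H'))).exists_isAssociated
    -- An atom of `Q'` lands outside `F`, hence on the image of an atom of `H'`; equalities under
    -- `G` between these atoms transfer to `σ`.
    have key : ∀ a ∈ Q', ∀ b ∈ H', a.subst G = b.subst G → a.subst σ = b.subst σ := by
      intro a ha b hb hab
      refine Atom.subst_eq_subst_of_imp hab fun s hs t ht hst => hσ.2 s t ?_
      exact kernelOn_apply.2 (Or.inr ⟨Or.inl ⟨a, ha, hs⟩, Or.inr ⟨b, hb, ht⟩, hst⟩)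
    refine ⟨σ, hσ, Finset.Subset.antisymm ?_ ?_⟩
    · intro c hc
      obtain ⟨a, ha, rfl⟩ := mem_substAtoms.1 hc
      have ha' := (hQ' a).1 ha
      rcases Finset.mem_union.1 (hQ (mem_substAtoms.2 ⟨a, ha'.1, rfl⟩)) with h | h
      · exact (ha'.2 h).elim
      · obtain ⟨b, hb, hab⟩ := mem_substAtoms.1 h
        have hb' : b ∈ H' := (hH' b).2 ⟨hb, a, ha, hab.symm⟩
        exact mem_substAtoms.2 ⟨b, hb', (key a ha b hb' hab.symm).symm⟩
    · intro c hc
      obtain ⟨b, hb, rfl⟩ := mem_substAtoms.1 hc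
      obtain ⟨_, a, ha, hab⟩ := (hH' b).1 hb
      exact mem_substAtoms.2 ⟨a, ha, key a ha b hb hab⟩
  existential := by
    have hsub : H' ⊆ H := fun a ha => ((hH' a).1 ha).1
    intro z hz t hzt hne
    have hzH : z ∈ vars H \ vars B := ⟨vars_mono hsub hz.1, hz.2⟩
    obtain ⟨w, hw, hwF⟩ := hfresh z hzH
    rcases kernelOn_apply.1 hzt with h | ⟨_, ht, heq⟩
    · exact (hne h.symm).elim
    have heq : t.subst G = Term.var w := heq.symm.trans hw
    -- `t` is sent to the fresh `w`, so it occurs in no atoms sent into `F`. Used for `Q \ Q'` (`t`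
    -- is not separating) and for `B` (`t` would be existential, hence equal to `z` by injectivity).
    have notF : ∀ S : CQ V, substAtoms G S ⊆ F → t ∉ terms S := by
      intro S hS htS
      have : t.subst G ∈ terms (substAtoms G S) := terms_substAtoms G S ▸ ⟨t, htS, rfl⟩
      exact hwF (mem_vars_iff.2 (heq ▸ terms_mono hS this))
    cases t with
    | const c => cases heq
    | var x =>
      rcases ht with ht | ht
      · refine ⟨x, ⟨ht, notF _ ?_⟩, rfl⟩
        intro c hc
        obtain ⟨a, ha, rfl⟩ := mem_substAtoms.1 hc
        obtain ⟨ha, ha'⟩ := Finset.mem_sdiff.1 ha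
        by_contra haF
        exact ha' ((hQ' a).2 ⟨ha, haF⟩)
      · have hxH : x ∈ vars H \ vars B := ⟨terms_mono hsub ht, notF _ hB⟩
        exact (hne (congrArg _ (hinj x hxH z hzH (heq.trans hw.symm)))).elim

/-- The involution exchanges the blocks `[0, M)` and `[K, K + M)`, disjoint since `M ≤ K`. -/
theorem exists_perm_shift (M K : ℕ) (h : M ≤ K) :
    ∃ ρ : Equiv.Perm ℕ, ∀ x < M, ρ x = x + K := by
  let f : ℕ → ℕ := fun x => if x < M then x + K else if K ≤ x ∧ x < K + M then x - K else x
  have hf : Function.Involutive f := by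
    intro x
    simp only [f]
    split_ifs <;> omega
  exact ⟨hf.toPerm, fun x hx => if_pos hx⟩

/-- Safe copies exist. -/
theorem exists_safe_copies {n : ℕ} (Q : Fin n → CQ V) {X : Set Var} (hX : X.Finite) :
    ∃ ρ : Fin n → Equiv.Perm Var, (∀ i, Disjoint (vars (rename (ρ i) (Q i))) X) ∧
      ∀ i j, i ≠ j → Disjoint (vars (rename (ρ i) (Q i))) (vars (rename (ρ j) (Q j))) := by
  obtain ⟨M, hM⟩ := (hX.union (Set.finite_iUnion fun i => finite_vars (Q i))).bddAbove
  have hX' : ∀ x ∈ X, x < M + 1 := fun x hx => Nat.lt_succ_of_le (hM (Or.inl hx))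
  have hQ' : ∀ i, ∀ x ∈ vars (Q i), x < M + 1 := fun i x hx =>
    Nat.lt_succ_of_le (hM (Or.inr (Set.mem_iUnion.2 ⟨i, hx⟩)))
  -- Copy `i` lives in block `i + 1` of length `M + 1`; block `0` is left to `X`. Division by `M +
  -- 1` recovers the block.
  have : ∀ i : Fin n, ∃ ρ : Equiv.Perm ℕ, ∀ x < M + 1, ρ x = x + (M + 1) * (i + 1) := fun i =>
    exists_perm_shift _ _ (Nat.le_mul_of_pos_right _ (Nat.succ_pos _))
  choose ρ hρ using this
  have hdiv : ∀ i, ∀ x ∈ vars (rename (ρ i) (Q i)), x / (M + 1) = i + 1 := by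
    intro i x hx
    rw [vars_rename] at hx
    obtain ⟨y, hy, rfl⟩ := hx
    rw [hρ i y (hQ' i y hy), Nat.add_mul_div_left _ _ (Nat.succ_pos _),
      Nat.div_eq_of_lt (hQ' i y hy), Nat.zero_add]
  refine ⟨ρ, fun i => Set.disjoint_left.2 fun x hx hx' => ?_, fun i j hij =>
    Set.disjoint_left.2 fun x hx hx' => hij (Fin.ext ?_)⟩
  · have := hdiv i x hx
    rw [Nat.div_eq_of_lt (hX' x hx')] at this
    exact Nat.succ_ne_zero _ this.symm
  · exact Nat.succ.inj ((hdiv i x hx).symm.trans (hdiv j x hx'))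

/-- If the result of every alternative of a rule application on `F` is mapped to by a query of
`A`, and none of these queries maps to `F`, then a rewriting step produces a query that maps
to `F`. -/
theorem exists_produces_homTo {A : UCQ V} {R : Rule V} {F : CQ V} {τ : Var → Term V}
    (hB : substAtoms τ R.body ⊆ F)
    (hfresh : ∀ i, ∀ z ∈ vars (R.head i) \ vars R.body, ∃ w, τ z = Term.var w ∧ w ∉ vars F)
    (hinj : ∀ i, ∀ z ∈ vars (R.head i) \ vars R.body, ∀ y ∈ vars (R.head i) \ vars R.body,
      τ z = τ y → z = y)
    {Q : Fin R.size → CQ V} (hQA : ∀ i, Q i ∈ A)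
    (hQ : ∀ i, HomTo (Q i) (F ∪ substAtoms τ (R.head i))) (hnot : ∀ i, ¬ HomTo (Q i) F) :
    ∃ μ : DisjPieceUnifier A R, ∃ Q', μ.Produces Q' ∧ HomTo Q' F := by
  classical
  obtain ⟨ρ, hρR, hρ⟩ := exists_safe_copies Q R.finite_vars
  choose g hg using hQ
  -- Disjointness of variables allows one substitution to combine the trigger with all the
  -- homomorphisms.
  obtain ⟨G, hGR, hGQ⟩ : ∃ G : Var → Term V, (∀ x ∈ R.vars, G x = τ x) ∧
      ∀ i, ∀ x ∈ vars (rename (ρ i) (Q i)), G x = g i ((ρ i).symm x) := by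
    refine ⟨fun x => if x ∈ R.vars then τ x
      else if h : ∃ i, x ∈ vars (rename (ρ i) (Q i)) then g h.choose ((ρ h.choose).symm x)
      else Term.var x, fun x hx => if_pos hx, fun i x hx => ?_⟩
    have hex : ∃ i, x ∈ vars (rename (ρ i) (Q i)) := ⟨i, hx⟩
    have hi : hex.choose = i := by
      by_contra hne
      exact Set.disjoint_left.1 (hρ _ _ hne) hex.choose_spec hx
    dsimp only
    rw [if_neg (Set.disjoint_left.1 (hρR i) hx), dif_pos hex, hi]
  have hcopy : ∀ i, substAtoms G (rename (ρ i) (Q i)) = substAtoms (g i) (Q i) := by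
    intro i
    rw [substAtoms_congr (hGQ i), rename, substAtoms_substAtoms]
    simp [Term.subst]
  have hbody : substAtoms G R.body = substAtoms τ R.body :=
    substAtoms_congr fun x hx => hGR x (Or.inl hx)
  have hheadR : ∀ i, ∀ x ∈ vars (R.head i), G x = τ x := fun i x hx =>
    hGR x (Or.inr (Set.mem_iUnion.2 ⟨i, hx⟩))
  have hhead : ∀ i, substAtoms G (R.head i) = substAtoms τ (R.head i) := fun i =>
    substAtoms_congr (hheadR i)
  let Q' : Fin R.size → CQ V := fun i => (rename (ρ i) (Q i)).filter fun a => a.subst G ∉ F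
  let H' : Fin R.size → CQ V := fun i =>
    (R.head i).filter fun b => ∃ a ∈ Q' i, a.subst G = b.subst G
  let P : Fin R.size → Setoid (Term V) := fun i => kernelOn G (terms (Q' i) ∪ terms (H' i))
  -- All partitions lie below the kernel of the same `G`, hence so does their join: this is what
  -- makes the unifiers compatible.
  have hP : ⨆ i, P i ≤ kernel G := iSup_le fun i => kernelOn_le _ _
  let μ : DisjPieceUnifier A R :=
    { source := Q
      source_mem := hQA
      ren := ρ
      disjoint_rule := hρR
      disjoint_copies := hρ
      queryPart := Q'
      headPart := H'
      partition := P
      isPieceUnifier := by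
        intro i
        refine isPieceUnifier_of_hom (F := F) ((hρR i).mono_right ?_) ?_ ?_ (hbody.trans_subset hB)
          ?_ ?_ (fun a => Finset.mem_filter) fun b => Finset.mem_filter
        · exact Set.union_subset_union_right _ (Set.subset_iUnion (fun i => vars (R.head i)) i)
        · rw [hcopy, hhead]
          exact hg i
        · rw [hcopy]
          exact fun h => hnot i ⟨_, h⟩
        · intro z hz
          rw [hheadR i z hz.1]
          exact hfresh i z hz
        · intro z hz y hy
          rw [hheadR i z hz.1, hheadR i y hy.1]
          exact hinj i z hz y hy
      admissible := admissible_of_le_kernel hP }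
  obtain ⟨σ, hσ⟩ := μ.admissible.exists_isAssociated
  -- `G` factors through `σ`, so `G` itself maps the produced CQ to `F`: the atoms it sends outside
  -- `F` were all put in `Q'`.
  have hGσ : ∀ S : CQ V, substAtoms G (substAtoms σ S) = substAtoms G S := by
    intro S
    rw [substAtoms_substAtoms]
    exact substAtoms_congr fun x _ => (kernel_apply.1 (hP (hσ.1 x))).symm
  refine ⟨μ, _, ⟨σ, hσ, rfl⟩, G, fun c hc => ?_⟩
  obtain ⟨b, hb, rfl⟩ := mem_substAtoms.1 hc
  rcases Finset.mem_union.1 hb with hb | hb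
  · have := mem_substAtoms.2 (⟨b, hb, rfl⟩ : ∃ c ∈ _, c.subst G = b.subst G)
    rw [hGσ, hbody] at this
    exact hB this
  · obtain ⟨i, _, hb⟩ := Finset.mem_biUnion.1 hb
    have := mem_substAtoms.2 (⟨b, hb, rfl⟩ : ∃ c ∈ _, c.subst G = b.subst G)
    rw [hGσ] at this
    obtain ⟨a, ha, ha'⟩ := mem_substAtoms.1 this
    obtain ⟨ha, hna⟩ := Finset.mem_sdiff.1 ha
    by_contra hF
    exact hna (Finset.mem_filter.2 ⟨ha, ha' ▸ hF⟩)

/-! ### Finiteness of the generated set of queries -/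

theorem finite_atoms {D : Set V.Pred} (hD : D.Finite) {T : Set (Term V)} (hT : T.Finite) :
    {a : Atom V | a.pred ∈ D ∧ a.terms ⊆ T}.Finite := by
  refine (hD.biUnion fun p _ => (Set.Finite.pi fun _ : Fin (V.arity p) => hT).image
    (Atom.mk p)).subset ?_
  rintro ⟨p, f⟩ ⟨hp, hf⟩
  exact Set.mem_biUnion hp ⟨f, fun j _ => hf ⟨j, rfl⟩, rfl⟩

theorem exists_perm_lt {s : Set Var} (hs : s.Finite) {N : ℕ} (hN : s.ncard ≤ N) :
    ∃ ρ : Equiv.Perm Var, ∀ x ∈ s, ρ x < N := by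
  obtain ⟨ρ, hρ⟩ := Equiv.Perm.exists_map_finset_eq hs.toFinset
    (Finset.range hs.toFinset.card) (by simp)
  refine ⟨ρ, fun x hx => ?_⟩
  have : ρ x ∈ Finset.range hs.toFinset.card :=
    hρ ▸ Finset.mem_map.2 ⟨x, hs.mem_toFinset.2 hx, rfl⟩
  rw [← Set.ncard_eq_toFinset_card s hs] at this
  exact (Finset.mem_range.1 this).trans_le hN

/-- Up to isomorphism, there are finitely many CQs with given predicates and constants and a
bounded number of variables. -/
theorem exists_finite_isomorphic {D : Set V.Pred} (hD : D.Finite) {C : Set V.Const}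
    (hC : C.Finite) (N : ℕ) :
    ∃ 𝒞 : Set (CQ V), 𝒞.Finite ∧ ∀ Q : CQ V, (∀ a ∈ Q, a.pred ∈ D) →
      (∀ c, Term.const c ∈ terms Q → c ∈ C) → (vars Q).ncard ≤ N → ∃ Q' ∈ 𝒞, Isomorphic Q' Q := by
  have hfin := finite_atoms hD ((hC.image Term.const).union
    ((Set.finite_Iio N).image (Term.var (V := V))))
  refine ⟨(hfin.toFinset.powerset : Set (CQ V)), Finset.finite_toSet _, fun Q hQD hQC hQN => ?_⟩
  obtain ⟨ρ, hρ⟩ := exists_perm_lt (finite_vars Q) hQN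
  refine ⟨rename ρ Q, ?_, Isomorphic.symm ⟨ρ, rfl⟩⟩
  rw [Finset.mem_coe, Finset.mem_powerset]
  intro b hb
  rw [Set.Finite.mem_toFinset]
  obtain ⟨a, ha, rfl⟩ := mem_substAtoms.1 hb
  refine ⟨hQD a ha, ?_⟩
  rintro _ ⟨j, rfl⟩
  have hj : a.args j ∈ terms Q := ⟨a, ha, j, rfl⟩
  change (a.args j).subst _ ∈ _
  cases h : a.args j with
  | const c => exact Or.inl ⟨c, hQC c (h ▸ hj), rfl⟩
  | var x => exact Or.inr ⟨ρ x, hρ x (mem_vars_iff.2 (h ▸ hj)), rfl⟩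

/-- The atoms occurring in a set of queries or in a set of rules. -/
noncomputable def allAtoms (A : UCQ V) (ℛ : Finset (Rule V)) : CQ V :=
  A.biUnion id ∪ ℛ.biUnion fun R => R.body ∪ Finset.univ.biUnion R.head

theorem subset_allAtoms_of_mem {A : UCQ V} {ℛ : Finset (Rule V)} {Q : CQ V} (h : Q ∈ A) :
    Q ⊆ allAtoms A ℛ :=
  fun _ ha => Finset.mem_union_left _ (Finset.mem_biUnion.2 ⟨Q, h, ha⟩)

theorem body_subset_allAtoms {A : UCQ V} {ℛ : Finset (Rule V)} {R : Rule V} (h : R ∈ ℛ) :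
    R.body ⊆ allAtoms A ℛ :=
  fun _ ha => Finset.mem_union_right _
    (Finset.mem_biUnion.2 ⟨R, h, Finset.mem_union_left _ ha⟩)

theorem head_subset_allAtoms {A : UCQ V} {ℛ : Finset (Rule V)} {R : Rule V} (h : R ∈ ℛ)
    (i : Fin R.size) : R.head i ⊆ allAtoms A ℛ :=
  fun _ ha => Finset.mem_union_right _ (Finset.mem_biUnion.2
    ⟨R, h, Finset.mem_union_right _ (Finset.mem_biUnion.2 ⟨i, Finset.mem_univ _, ha⟩)⟩)

theorem Rule.vars_subset_allAtoms {A : UCQ V} {ℛ : Finset (Rule V)} {R : Rule V} (h : R ∈ ℛ) :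
    R.vars ⊆ DisjRewriting.vars (allAtoms A ℛ) :=
  Set.union_subset (vars_mono (body_subset_allAtoms h))
    (Set.iUnion_subset fun i => vars_mono (head_subset_allAtoms h i))

theorem const_mem_terms_rename {ρ : Equiv.Perm Var} {S : CQ V} {c : V.Const}
    (h : Term.const c ∈ terms (rename ρ S)) : Term.const c ∈ terms S := by
  rw [rename, terms_substAtoms] at h
  obtain ⟨t, ht, h⟩ := h
  cases t with
  | const d => exact h ▸ ht
  | var x => cases h

namespace DisjPieceUnifier

variable {A : UCQ V} {R : Rule V}

/-- The terms of the rule and of the safe copies. -/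
def allTerms (μ : DisjPieceUnifier A R) : Set (Term V) :=
  terms R.body ∪ (⋃ i, terms (R.head i)) ∪ ⋃ i, terms (μ.copy i)

theorem join_apply (μ : DisjPieceUnifier A R) {s t : Term V} (h : μ.join s t) :
    s = t ∨ (s ∈ μ.allTerms ∧ t ∈ μ.allTerms) := by
  -- Collapsing `allTerms` to one class bounds every partition from above, hence also their join.
  let E : Setoid (Term V) :=
    { r := fun s t => s = t ∨ (s ∈ μ.allTerms ∧ t ∈ μ.allTerms)
      iseqv := ⟨fun _ => Or.inl rfl, fun h => h.imp Eq.symm And.symm, by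
        rintro r s t (rfl | h) (rfl | h')
        · exact Or.inl rfl
        · exact Or.inr h'
        · exact Or.inr h
        · exact Or.inr ⟨h.1, h'.2⟩⟩ }
  have hE : μ.join ≤ E := by
    refine iSup_le fun i s t hst => ?_
    have hsub : terms (μ.queryPart i) ∪ terms (μ.headPart i) ⊆ μ.allTerms :=
      Set.union_subset
        ((terms_mono (μ.isPieceUnifier i).subset_query).trans fun _ h =>
          Or.inr (Set.mem_iUnion.2 ⟨i, h⟩))
        ((terms_mono (μ.isPieceUnifier i).subset_head).trans fun _ h =>
          Or.inl (Or.inr (Set.mem_iUnion.2 ⟨i, h⟩)))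
    exact ((μ.isPieceUnifier i).partition s t hst).imp_right fun h => ⟨hsub h.1, hsub h.2⟩
  exact hE h

theorem mem_apply {μ : DisjPieceUnifier A R} {σ : Var → Term V} {a : Atom V} :
    a ∈ μ.apply σ → ∃ b, (b ∈ R.body ∨ ∃ i, b ∈ μ.copy i) ∧ b.subst σ = a := by
  intro h
  rcases Finset.mem_union.1 h with h | h
  · obtain ⟨b, hb, rfl⟩ := mem_substAtoms.1 h
    exact ⟨b, Or.inl hb, rfl⟩
  · obtain ⟨i, _, h⟩ := Finset.mem_biUnion.1 h
    obtain ⟨b, hb, rfl⟩ := mem_substAtoms.1 h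
    exact ⟨b, Or.inr ⟨i, Finset.sdiff_subset hb⟩, rfl⟩

variable {μ : DisjPieceUnifier A R} {Q : CQ V}

theorem Produces.terms_subset (h : μ.Produces Q) : terms Q ⊆ μ.allTerms := by
  obtain ⟨σ, hσ, rfl⟩ := h
  rintro _ ⟨a, ha, j, rfl⟩
  obtain ⟨b, hb, rfl⟩ := mem_apply ha
  have hj : b.args j ∈ μ.allTerms := by
    rcases hb with hb | ⟨i, hb⟩
    · exact Or.inl (Or.inl ⟨b, hb, j, rfl⟩)
    · exact Or.inr (Set.mem_iUnion.2 ⟨i, b, hb, j, rfl⟩)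
  change (b.args j).subst σ ∈ _
  rcases μ.join_apply (hσ.rel_subst (b.args j)) with h | h
  · rwa [← h]
  · exact h.2

variable {ℛ : Finset (Rule V)}

theorem Produces.pred_mem (h : μ.Produces Q) (hR : R ∈ ℛ) {a : Atom V} (ha : a ∈ Q) :
    a.pred ∈ Atom.pred '' (allAtoms A ℛ : Set (Atom V)) := by
  obtain ⟨σ, hσ, rfl⟩ := h
  obtain ⟨b, hb | ⟨i, hb⟩, rfl⟩ := mem_apply ha
  · exact ⟨b, body_subset_allAtoms hR hb, rfl⟩
  · obtain ⟨c, hc, rfl⟩ := mem_substAtoms.1 hb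
    exact ⟨c, subset_allAtoms_of_mem (μ.source_mem i) hc, rfl⟩

theorem Produces.const_mem (h : μ.Produces Q) (hR : R ∈ ℛ) {c : V.Const}
    (hc : Term.const c ∈ terms Q) : Term.const c ∈ terms (allAtoms A ℛ) := by
  rcases h.terms_subset hc with (h | h) | h
  · exact terms_mono (body_subset_allAtoms hR) h
  · obtain ⟨i, h⟩ := Set.mem_iUnion.1 h
    exact terms_mono (head_subset_allAtoms hR i) h
  · obtain ⟨i, h⟩ := Set.mem_iUnion.1 h
    exact terms_mono (subset_allAtoms_of_mem (μ.source_mem i)) (const_mem_terms_rename h)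

/-- One summand is for the rule, the other for its `R.size` copies. The names in the copies are
arbitrary, so only the number of variables can be bounded. -/
theorem Produces.ncard_vars_le (h : μ.Produces Q) (hR : R ∈ ℛ) :
    (vars Q).ncard ≤
      (vars (allAtoms A ℛ)).ncard + R.size * (vars (allAtoms A ℛ)).ncard := by
  have hsub : vars Q ⊆ R.vars ∪ ⋃ i, vars (μ.copy i) := by
    intro x hx
    rcases h.terms_subset hx with (h | h) | h
    · exact Or.inl (Or.inl h)
    · obtain ⟨i, h⟩ := Set.mem_iUnion.1 h
      exact Or.inl (Or.inr (Set.mem_iUnion.2 ⟨i, h⟩))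
    · obtain ⟨i, h⟩ := Set.mem_iUnion.1 h
      exact Or.inr (Set.mem_iUnion.2 ⟨i, h⟩)
  have hcopy : ∀ i, (vars (μ.copy i)).ncard ≤ (vars (allAtoms A ℛ)).ncard := by
    intro i
    rw [copy, vars_rename, Set.ncard_image_of_injective _ (μ.ren i).injective]
    exact Set.ncard_le_ncard (vars_mono (subset_allAtoms_of_mem (μ.source_mem i)))
      (finite_vars _)
  refine (Set.ncard_le_ncard hsub (R.finite_vars.union
    (Set.finite_iUnion fun i => finite_vars _))).trans ((Set.ncard_union_le _ _).trans ?_)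
  refine Nat.add_le_add
    (Set.ncard_le_ncard (Rule.vars_subset_allAtoms hR) (finite_vars _)) ?_
  refine (Set.ncard_iUnion_le_of_fintype _).trans ?_
  simpa using Finset.sum_le_card_nsmul Finset.univ _ _ fun i _ => hcopy i

end DisjPieceUnifier

/-- Predicates, constants and the number of variables of produced CQs are bounded, so finitely many
isomorphism types occur; one produced CQ is picked in each. -/
theorem exists_isGenerated (star prev : UCQ V) (ℛ : Finset (Rule V)) :
    ∃ G : UCQ V, IsGenerated star prev ℛ G := by
  classical
  obtain ⟨𝒞, h𝒞, hiso⟩ := exists_finite_isomorphic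
    ((allAtoms star ℛ).finite_toSet.image Atom.pred)
    ((finite_terms (allAtoms star ℛ)).preimage
      (f := Term.const) fun _ _ _ _ h => by injection h)
    -- The sum dominates the bound of each rule.
    (∑ R ∈ ℛ, ((vars (allAtoms star ℛ)).ncard + R.size * (vars (allAtoms star ℛ)).ncard))
  have hiso' : ∀ Q, NewlyProduced star prev ℛ Q → ∃ C ∈ 𝒞, Isomorphic C Q := by
    rintro Q ⟨R, hR, μ, -, hQ⟩
    refine hiso Q (fun a ha => hQ.pred_mem hR ha) (fun c hc => hQ.const_mem hR hc)
      ((hQ.ncard_vars_le hR).trans ?_)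
    exact Finset.single_le_sum (f := fun R : Rule V =>
      (vars (allAtoms star ℛ)).ncard + R.size * (vars (allAtoms star ℛ)).ncard)
      (fun _ _ => Nat.zero_le _) hR
  let 𝒞' : Set (CQ V) := {C ∈ 𝒞 | ∃ Q, NewlyProduced star prev ℛ Q ∧ Isomorphic C Q}
  have h𝒞' : 𝒞'.Finite := h𝒞.subset fun _ h => h.1
  have : ∀ C : CQ V, ∃ Q, C ∈ 𝒞' → NewlyProduced star prev ℛ Q ∧ Isomorphic C Q := by
    intro C
    by_cases hC : C ∈ 𝒞'
    · exact hC.2.imp fun _ h _ => h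
    · exact ⟨∅, fun h => (hC h).elim⟩
  choose f hf using this
  refine ⟨h𝒞'.toFinset.image f, fun Q hQ => ?_, fun Q hQ => ?_⟩
  · obtain ⟨C, hC, rfl⟩ := Finset.mem_image.1 hQ
    exact (hf C (h𝒞'.mem_toFinset.1 hC)).1
  · obtain ⟨C, hC, hCQ⟩ := hiso' Q hQ
    have hC' : C ∈ 𝒞' := ⟨hC, Q, hQ, hCQ⟩
    exact ⟨f C, Finset.mem_image_of_mem f (h𝒞'.mem_toFinset.2 hC'), (hf C hC').2.symm.trans hCQ⟩

/-! ### Minimal unions of conjunctive queries -/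

/-- A CQ to which another one maps can be erased. Minimality becomes a pairwise condition, which can
be checked across the removals of a step. -/
theorem isMinimal_iff {A : UCQ V} :
    IsMinimal A ↔ ∀ Q ∈ A, ∀ Q' ∈ A, HomTo Q' Q → Q' = Q := by
  constructor
  · intro h Q hQ Q' hQ' hom
    by_contra hne
    refine h (A.erase Q) (Finset.erase_ssubset hQ) ⟨entails_iff.2 fun P hP => ?_, ?_⟩
    · by_cases hPQ : P = Q
      · exact ⟨Q', Finset.mem_coe.2 (Finset.mem_erase.2 ⟨hne, hQ'⟩), hPQ ▸ hom⟩
      · exact ⟨P, Finset.mem_coe.2 (Finset.mem_erase.2 ⟨hPQ, hP⟩), HomTo.refl P⟩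
    · exact entails_iff.2 fun P hP => ⟨P, Finset.mem_of_mem_erase hP, HomTo.refl P⟩
  · intro h A' hA' heq
    obtain ⟨Q, hQ, hQ'⟩ := Finset.exists_of_ssubset hA'
    obtain ⟨P, hP, hom⟩ := entails_iff.1 heq.1 Q hQ
    exact hQ' (h Q hQ P (hA'.1 hP) hom ▸ hP)

theorem exists_isCover (A : UCQ V) : ∃ K, IsCover A K := by
  induction A using Finset.strongInduction with
  | H A ih =>
    by_cases h : IsMinimal A
    · exact ⟨A, subset_rfl, ⟨Entails.refl _, Entails.refl _⟩, h⟩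
    · unfold IsMinimal at h
      push Not at h
      obtain ⟨A', hA', heq⟩ := h
      obtain ⟨K, hK, heq', hmin⟩ := ih A' hA'
      exact ⟨K, hK.trans hA'.1, ⟨heq.1.trans heq'.1, heq'.2.trans heq.2⟩, hmin⟩

theorem mem_removeMoreSpecific {A B : UCQ V} {Q : CQ V} :
    Q ∈ removeMoreSpecific A B ↔ Q ∈ A ∧ ¬ ∃ Q' ∈ B, HomTo Q' Q := by
  simp [removeMoreSpecific, entails_singleton]

/-! ### The disjunctive chase -/

/-- The trigger `h` of the rule `R` is satisfied in `F`. -/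
def Satisfied (F : CQ V) (R : Rule V) (h : Var → Term V) : Prop :=
  ∃ i, ∃ h' : Var → Term V, (∀ x ∈ vars R.body, h' x = h x) ∧ substAtoms h' (R.head i) ⊆ F

theorem Satisfied.mono {F F' : CQ V} {R : Rule V} {h : Var → Term V} (hF : F ⊆ F') :
    Satisfied F R h → Satisfied F' R h :=
  fun ⟨i, h', hh, hs⟩ => ⟨i, h', hh, hs.trans hF⟩

theorem Satisfied.congr {F : CQ V} {R : Rule V} {h k : Var → Term V}
    (hk : ∀ x ∈ vars R.body, h x = k x) : Satisfied F R h → Satisfied F R k :=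
  fun ⟨i, h', hh, hs⟩ => ⟨i, h', fun x hx => (hh x hx).trans (hk x hx), hs⟩

/-- The assignments of the variables of `B` by terms of `F` are finitely many. -/
theorem exists_finite_triggers (B F : CQ V) :
    ∃ H : Set (Var → Term V), H.Finite ∧
      ∀ h, substAtoms h B ⊆ F → ∃ k ∈ H, ∀ x ∈ vars B, k x = h x := by
  classical
  have := (finite_vars B).to_subtype
  have := (finite_terms F).to_subtype
  refine ⟨Set.range fun (f : vars B → terms F) x =>
    if hx : x ∈ vars B then (f ⟨x, hx⟩ : Term V) else Term.var x, Set.finite_range _,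
    fun h hh => ⟨_, ⟨fun x => ⟨h x, ?_⟩, rfl⟩, fun x hx => dif_pos hx⟩⟩
  refine terms_mono hh ?_
  rw [terms_substAtoms]
  exact ⟨Term.var x, x.2, rfl⟩

theorem exists_subset_of_subset_iUnion {F : ℕ → CQ V} (hF : Monotone F) {S : CQ V}
    (h : ∀ a ∈ S, ∃ n, a ∈ F n) : ∃ n, S ⊆ F n := by
  choose! f hf using h
  exact ⟨S.sup f, fun a ha => hF (Finset.le_sup ha) (hf a ha)⟩

section

variable {A : ℕ → UCQ V} {ℛ : Finset (Rule V)}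

/-- The chase step: some disjunct can be added without `F` becoming covered, for otherwise a
rewriting step would already cover `F`. -/
theorem exists_extension_satisfying (hmono : ∀ m n, m ≤ n → Entails (A m : Set (CQ V)) (A n))
    (hstep : ∀ n, ∀ R ∈ ℛ, ∀ μ : DisjPieceUnifier (A n) R, ∀ Q, μ.Produces Q →
      FactsEntail Q (A (n + 1) : Set (CQ V)))
    {F : CQ V} (hF : ∀ n, ¬ FactsEntail F (A n : Set (CQ V))) {R : Rule V} (hR : R ∈ ℛ)
    {h : Var → Term V} (hh : substAtoms h R.body ⊆ F) :
    ∃ F', F ⊆ F' ∧ (∀ n, ¬ FactsEntail F' (A n : Set (CQ V))) ∧ Satisfied F' R h := by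
  classical
  obtain ⟨N, hN⟩ := exists_vars_lt F
  -- The shift by `N` makes the existential variables fresh for `F` and keeps them distinct.
  let τ : Var → Term V := fun x => if x ∈ vars R.body then h x else Term.var (x + N)
  have hτ : ∀ x ∈ vars R.body, τ x = h x := fun x hx => if_pos hx
  have hτ' : ∀ x, x ∉ vars R.body → τ x = Term.var (x + N) := fun x hx => if_neg hx
  by_contra hcon
  have hall : ∀ i, ∃ n, FactsEntail (F ∪ substAtoms τ (R.head i)) (A n : Set (CQ V)) := by
    intro i
    by_contra! hbad
    exact hcon ⟨_, Finset.subset_union_left, hbad, i, τ, hτ, Finset.subset_union_right⟩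
  choose n hn using hall
  -- Monotonicity brings the finitely many disjuncts to a common stage.
  have hQ : ∀ i, ∃ Q ∈ A (Finset.univ.sup n), HomTo Q (F ∪ substAtoms τ (R.head i)) := fun i =>
    factsEntail_iff.1 ((hn i).trans (hmono _ _ (Finset.le_sup (Finset.mem_univ i))))
  choose Q hQA hQ using hQ
  obtain ⟨μ, Q', hQ', hom⟩ := exists_produces_homTo (τ := τ) (F := F)
    ((substAtoms_congr hτ).trans_subset hh)
    (fun i z hz => ⟨z + N, hτ' z hz.2, fun hlt => (Nat.not_lt.2 (Nat.le_add_left N z)) (hN _ hlt)⟩)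
    (fun i z hz y hy hzy => by
      rw [hτ' z hz.2, hτ' y hy.2] at hzy
      injection hzy with hzy
      exact Nat.add_right_cancel hzy)
    hQA hQ (fun i hi => hF _ (factsEntail_iff.2 ⟨Q i, hQA i, hi⟩))
  exact hF _ (FactsEntail.of_homTo hom (hstep _ R hR μ Q' hQ'))

/-- One fair round: the triggers on `F`, finitely many up to agreement on the body, are treated in
turn, and satisfied triggers stay satisfied. -/
theorem exists_extension_satisfying_all
    (hmono : ∀ m n, m ≤ n → Entails (A m : Set (CQ V)) (A n))
    (hstep : ∀ n, ∀ R ∈ ℛ, ∀ μ : DisjPieceUnifier (A n) R, ∀ Q, μ.Produces Q →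
      FactsEntail Q (A (n + 1) : Set (CQ V)))
    {F : CQ V} (hF : ∀ n, ¬ FactsEntail F (A n : Set (CQ V))) :
    ∃ F', F ⊆ F' ∧ (∀ n, ¬ FactsEntail F' (A n : Set (CQ V))) ∧
      ∀ R ∈ ℛ, ∀ h, substAtoms h R.body ⊆ F → Satisfied F' R h := by
  classical
  have hfin : ∀ T : Finset (Rule V × (Var → Term V)), ∃ F', F ⊆ F' ∧
      (∀ n, ¬ FactsEntail F' (A n : Set (CQ V))) ∧
      ∀ p ∈ T, p.1 ∈ ℛ → substAtoms p.2 p.1.body ⊆ F → Satisfied F' p.1 p.2 := by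
    intro T
    induction T using Finset.induction_on with
    | empty => exact ⟨F, subset_rfl, hF, by simp⟩
    | insert p T _ ih =>
      obtain ⟨F', hFF', hbad, hsat⟩ := ih
      by_cases hp : p.1 ∈ ℛ ∧ substAtoms p.2 p.1.body ⊆ F
      · obtain ⟨F'', hFF'', hbad', hsat'⟩ :=
          exists_extension_satisfying hmono hstep hbad hp.1 (hp.2.trans hFF')
        refine ⟨F'', hFF'.trans hFF'', hbad', fun q hq hqR hqF => ?_⟩
        rcases Finset.mem_insert.1 hq with rfl | hq
        · exact hsat'
        · exact (hsat q hq hqR hqF).mono hFF''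
      · refine ⟨F', hFF', hbad, fun q hq hqR hqF => ?_⟩
        rcases Finset.mem_insert.1 hq with rfl | hq
        · exact (hp ⟨hqR, hqF⟩).elim
        · exact hsat q hq hqR hqF
  choose H hHfin hH using fun R : Rule V => exists_finite_triggers R.body F
  have hT : (⋃ R ∈ ℛ, Prod.mk R '' H R).Finite :=
    ℛ.finite_toSet.biUnion fun R _ => (hHfin R).image _
  obtain ⟨F', hFF', hbad, hsat⟩ := hfin hT.toFinset
  refine ⟨F', hFF', hbad, fun R hR h hh => ?_⟩
  obtain ⟨k, hk, hkh⟩ := hH R h hh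
  refine (hsat (R, k) ?_ hR ((substAtoms_congr hkh).trans_subset hh)).congr hkh
  exact hT.mem_toFinset.2 (Set.mem_biUnion (Finset.mem_coe.2 hR) ⟨k, hk, rfl⟩)

/-- An increasing sequence of UCQs that is closed under rewriting steps eventually covers all the
fact bases that entail the initial query. -/
theorem exists_factsEntail_of_kbEntails {𝒬 : UCQ V}
    (hinit : Entails (𝒬 : Set (CQ V)) (A 0))
    (hmono : ∀ m n, m ≤ n → Entails (A m : Set (CQ V)) (A n))
    (hstep : ∀ n, ∀ R ∈ ℛ, ∀ μ : DisjPieceUnifier (A n) R, ∀ Q, μ.Produces Q →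
      FactsEntail Q (A (n + 1) : Set (CQ V)))
    {F : CQ V} (hF : KBEntails F ℛ 𝒬) : ∃ n, FactsEntail F (A n : Set (CQ V)) := by
  by_contra! hbad
  let Bad := {F : CQ V // ∀ n, ¬ FactsEntail F (A n : Set (CQ V))}
  choose ext hext hextbad hsat using fun F : Bad =>
    exists_extension_satisfying_all hmono hstep F.2
  -- Only one bad branch is followed, so no chase tree is needed.
  let chase : ℕ → Bad := Nat.rec ⟨F, hbad⟩ fun _ F => ⟨ext F, hextbad F⟩
  have hchase : Monotone fun n : ℕ => (chase n).1 :=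
    monotone_nat_of_le_succ (f := fun n : ℕ => (chase n).1) fun n => hext (chase n)
  let I := Interpretation.canonical {a : Atom V | ∃ n, a ∈ (chase n).1}
  -- A finite set of atoms true in the union is already true at a finite stage; this serves for rule
  -- bodies as well as for `𝒬`.
  have holds : ∀ (e : Var → Term V) (S : CQ V),
      (∀ a ∈ S, I.Holds e a) ↔ ∃ n, substAtoms e S ⊆ (chase n).1 := by
    intro e S
    constructor
    · intro h
      refine exists_subset_of_subset_iUnion hchase fun b hb => ?_
      obtain ⟨a, ha, rfl⟩ := mem_substAtoms.1 hb
      exact (Interpretation.canonical_holds _ _ _).1 (h a ha)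
    · rintro ⟨n, hn⟩ a ha
      exact (Interpretation.canonical_holds _ _ _).2 ⟨n, hn (mem_substAtoms.2 ⟨a, ha, rfl⟩)⟩
  obtain ⟨Q, hQ, e, he⟩ := hF I
    ⟨Term.var, (holds _ _).2 ⟨0, (substAtoms_var F).subset⟩⟩ (by
      intro R hR e he
      obtain ⟨n, hn⟩ := (holds e _).1 he
      obtain ⟨i, h', hh', hs⟩ := hsat (chase n) R hR e hn
      exact ⟨i, h', hh', (holds h' _).2 ⟨n + 1, hs⟩⟩)
  obtain ⟨n, hn⟩ := (holds e _).1 he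
  obtain ⟨P, hP, hom⟩ := entails_iff.1 hinit Q hQ
  exact (chase n).2 0 (factsEntail_iff.2 ⟨P, hP, hom.trans ⟨e, hn⟩⟩)

end

/-! ### Executions of the algorithm -/

theorem exists_step {ℛ : Finset (Rule V)} {s : State V} (h : ¬ s.Halted) :
    ∃ s', Step ℛ s s' := by
  obtain ⟨G, hG⟩ := exists_isGenerated s.star s.new ℛ
  obtain ⟨K, hK⟩ := exists_isCover G
  exact ⟨⟨removeMoreSpecific s.star (removeMoreSpecific K s.star) ∪ removeMoreSpecific K s.star,
    removeMoreSpecific K s.star⟩, h, G, K, hG, hK, rfl, rfl⟩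

theorem exists_isInitial (𝒬 : UCQ V) : ∃ s : State V, IsInitial 𝒬 s := by
  obtain ⟨K, hK⟩ := exists_isCover 𝒬
  exact ⟨⟨K, K⟩, hK, rfl⟩

namespace Step

variable {ℛ : Finset (Rule V)} {s s' : State V}

theorem entails_star (h : Step ℛ s s') : Entails (s.star : Set (CQ V)) s'.star := by
  obtain ⟨-, G, K, hG, hK, hnew, hstar⟩ := h
  refine entails_iff.2 fun Q hQ => ?_
  rw [hstar]
  by_cases hex : ∃ Q' ∈ s'.new, HomTo Q' Q
  · obtain ⟨Q', hQ', hom⟩ := hex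
    exact ⟨Q', Finset.mem_coe.2 (Finset.mem_union_right _ hQ'), hom⟩
  · exact ⟨Q, Finset.mem_coe.2 (Finset.mem_union_left _ (mem_removeMoreSpecific.2 ⟨hQ, hex⟩)),
      HomTo.refl Q⟩

theorem newlyProduced_of_mem_new (h : Step ℛ s s') {Q : CQ V} (hQ : Q ∈ s'.new) :
    NewlyProduced s.star s.new ℛ Q := by
  obtain ⟨-, G, K, hG, hK, hnew, hstar⟩ := h
  rw [hnew] at hQ
  exact hG.1 Q (hK.1 (mem_removeMoreSpecific.1 hQ).1)

theorem not_homTo_of_mem_new (h : Step ℛ s s') {Q Q' : CQ V} (hQ : Q ∈ s'.new)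
    (hQ' : Q' ∈ s.star) : ¬ HomTo Q' Q := by
  obtain ⟨-, G, K, hG, hK, hnew, hstar⟩ := h
  rw [hnew] at hQ
  exact fun hom => (mem_removeMoreSpecific.1 hQ).2 ⟨Q', hQ', hom⟩

theorem mem_star (h : Step ℛ s s') {Q : CQ V} (hQ : Q ∈ s'.star) : Q ∈ s.star ∨ Q ∈ s'.new := by
  obtain ⟨-, G, K, hG, hK, hnew, hstar⟩ := h
  rw [hstar] at hQ
  exact (Finset.mem_union.1 hQ).imp_left fun h => (mem_removeMoreSpecific.1 h).1

/-- The cover contains a CQ at least as general as `Q`; if it is discarded, `star` had a more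
general one, and `s'.star` still covers that. -/
theorem factsEntail_of_newlyProduced (h : Step ℛ s s') {Q : CQ V}
    (hQ : NewlyProduced s.star s.new ℛ Q) : FactsEntail Q (s'.star : Set (CQ V)) := by
  have hent := h.entails_star
  obtain ⟨-, G, K, hG, hK, hnew, hstar⟩ := h
  obtain ⟨Q', hQ', hiso⟩ := hG.2 Q hQ
  obtain ⟨P, hP, hom⟩ := entails_iff.1 hK.2.1.1 Q' hQ'
  have hom := hom.trans hiso.homTo
  by_cases hex : ∃ P' ∈ s.star, HomTo P' P
  · obtain ⟨P', hP', hom'⟩ := hex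
    exact FactsEntail.trans (factsEntail_iff.2 ⟨P', hP', hom'.trans hom⟩) hent
  · refine factsEntail_iff.2 ⟨P, ?_, hom⟩
    rw [hstar, Finset.mem_coe, hnew]
    exact Finset.mem_union_right _ (mem_removeMoreSpecific.2 ⟨hP, hex⟩)

/-- Old and new CQs each form an antichain, and the two removals exclude homomorphisms between them,
one direction each. -/
theorem isMinimal_star (h : Step ℛ s s') (hs : IsMinimal s.star) : IsMinimal s'.star := by
  obtain ⟨-, G, K, hG, hK, hnew, hstar⟩ := h
  have hs := isMinimal_iff.1 hs
  have hK := isMinimal_iff.1 hK.2.2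
  refine isMinimal_iff.2 fun Q hQ Q' hQ' hom => ?_
  rw [hstar, Finset.mem_union, mem_removeMoreSpecific, hnew, mem_removeMoreSpecific] at hQ hQ'
  rcases hQ with hQ | hQ <;> rcases hQ' with hQ' | hQ'
  · exact hs Q hQ.1 Q' hQ'.1 hom
  · exact (hQ.2 ⟨Q', mem_removeMoreSpecific.2 hQ', hom⟩).elim
  · exact (hQ.2 ⟨Q', hQ'.1, hom⟩).elim
  · exact hK Q hQ.1 Q' hQ'.1 hom

end Step

theorem IsRewriting.of_forall_mem {𝒬 : UCQ V} {ℛ : Finset (Rule V)} {A : Set (CQ V)}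
    (h : ∀ Q ∈ A, KBEntails Q ℛ 𝒬) : IsRewriting 𝒬 ℛ A := by
  intro F hF I hI hR
  obtain ⟨Q, hQ, hom⟩ := factsEntail_iff.1 hF
  exact h Q hQ I (hom.modelsCQ hI) hR

theorem IsRewriting.kbEntails_of_mem {𝒬 : UCQ V} {ℛ : Finset (Rule V)} {A : Set (CQ V)}
    (h : IsRewriting 𝒬 ℛ A) {Q : CQ V} (hQ : Q ∈ A) : KBEntails Q ℛ 𝒬 :=
  h Q (factsEntail_iff.2 ⟨Q, hQ, HomTo.refl Q⟩)

theorem NewlyProduced.kbEntails {𝒬 star prev : UCQ V} {ℛ : Finset (Rule V)} {Q : CQ V}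
    (hQ : NewlyProduced star prev ℛ Q) (h : IsRewriting 𝒬 ℛ (star : Set (CQ V))) :
    KBEntails Q ℛ 𝒬 := by
  obtain ⟨R, hR, μ, -, hμ⟩ := hQ
  intro I hI hℛ
  obtain ⟨P, hP, hPI⟩ := hμ.modelsUnion hI (hℛ R hR)
  exact IsRewriting.kbEntails_of_mem h hP I hPI hℛ

namespace IsRun

variable {𝒬 : UCQ V} {ℛ : Finset (Rule V)} {s : ℕ → State V}

theorem entails_star_succ (h : IsRun 𝒬 ℛ s) (n : ℕ) :
    Entails ((s n).star : Set (CQ V)) (s (n + 1)).star := by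
  rcases h.2 n with h | h
  · exact h.entails_star
  · rw [h.2]
    exact Entails.refl _

theorem entails_star (h : IsRun 𝒬 ℛ s) (m n : ℕ) (hmn : m ≤ n) :
    Entails ((s m).star : Set (CQ V)) (s n).star :=
  Nat.le_induction (Entails.refl _) (fun n _ ih => ih.trans (h.entails_star_succ n)) n hmn

theorem entails_init (h : IsRun 𝒬 ℛ s) : Entails (𝒬 : Set (CQ V)) (s 0).star := by
  rw [h.1.2]
  exact h.1.1.2.1.1

theorem isRewriting_star (h : IsRun 𝒬 ℛ s) (n : ℕ) :
    IsRewriting 𝒬 ℛ ((s n).star : Set (CQ V)) := by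
  induction n with
  | zero =>
    rw [h.1.2]
    exact fun F hF I hI _ => (FactsEntail.trans hF h.1.1.2.1.2) I hI
  | succ n ih =>
    rcases h.2 n with hs | hs
    · refine IsRewriting.of_forall_mem fun Q hQ => ?_
      rcases hs.mem_star hQ with hQ | hQ
      · exact IsRewriting.kbEntails_of_mem ih hQ
      · exact (hs.newlyProduced_of_mem_new hQ).kbEntails ih
    · rw [hs.2]
      exact ih

theorem isMinimal_star (h : IsRun 𝒬 ℛ s) (n : ℕ) : IsMinimal (s n).star := by
  induction n with
  | zero =>
    rw [h.1.2]
    exact h.1.1.2.2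
  | succ n ih =>
    rcases h.2 n with hs | hs
    · exact hs.isMinimal_star ih
    · rw [hs.2]
      exact ih

/-- All the queries produced from `star`, and not only the new ones, entail the next `star`. -/
theorem factsEntail_of_produces (h : IsRun 𝒬 ℛ s) (n : ℕ) {R : Rule V} (hR : R ∈ ℛ)
    (μ : DisjPieceUnifier (s n).star R) {Q : CQ V} (hQ : μ.Produces Q) :
    FactsEntail Q ((s (n + 1)).star : Set (CQ V)) := by
  induction n with
  | zero =>
    -- At the start every CQ is new, and `R.size_pos` provides a disjunct that involves one.
    have hnew : μ.IsNew (s 0).new :=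
      ⟨⟨0, R.size_pos⟩, h.1.2 ▸ μ.source_mem _⟩
    rcases h.2 0 with hs | hs
    · exact hs.factsEntail_of_newlyProduced ⟨R, hR, μ, hnew, hQ⟩
    · obtain ⟨i, hi⟩ := hnew
      rw [hs.1] at hi
      exact (Finset.notMem_empty _ hi).elim
  | succ n ih =>
    by_cases hnew : μ.IsNew (s (n + 1)).new
    · rcases h.2 (n + 1) with hs | hs
      · exact hs.factsEntail_of_newlyProduced ⟨R, hR, μ, hnew, hQ⟩
      · obtain ⟨i, hi⟩ := hnew
        rw [hs.1] at hi
        exact (Finset.notMem_empty _ hi).elim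
    -- With no new source, `μ` is already a unifier of the previous `star`, and the induction
    -- hypothesis applies.
    · have hold : ∀ i, μ.source i ∈ (s n).star := by
        intro i
        rcases h.2 n with hs | hs
        · exact (hs.mem_star (μ.source_mem i)).resolve_right fun hi => hnew ⟨i, hi⟩
        · exact hs.2 ▸ μ.source_mem i
      let μ' : DisjPieceUnifier (s n).star R :=
        { source := μ.source
          source_mem := hold
          ren := μ.ren
          disjoint_rule := μ.disjoint_rule
          disjoint_copies := μ.disjoint_copies
          queryPart := μ.queryPart
          headPart := μ.headPart
          partition := μ.partition
          isPieceUnifier := μ.isPieceUnifier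
          admissible := μ.admissible }
      exact (ih μ' hQ).trans (h.entails_star_succ (n + 1))

theorem exists_factsEntail (h : IsRun 𝒬 ℛ s) {F : CQ V} (hF : KBEntails F ℛ 𝒬) :
    ∃ n, ∀ m, n ≤ m → FactsEntail F ((s m).star : Set (CQ V)) := by
  obtain ⟨n, hn⟩ := exists_factsEntail_of_kbEntails (A := fun n => (s n).star) h.entails_init
    h.entails_star (fun n R hR μ Q hQ => h.factsEntail_of_produces n hR μ hQ) hF
  exact ⟨n, fun m hm => FactsEntail.trans hn (h.entails_star n m hm)⟩

theorem eq_of_halted (h : IsRun 𝒬 ℛ s) {n : ℕ} (hn : (s n).Halted) (m : ℕ) (hm : n ≤ m) :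
    s m = s n := by
  induction m, hm using Nat.le_induction with
  | base => rfl
  | succ m _ ih =>
    rcases h.2 m with hs | hs
    · exact (hs.1 (ih ▸ hn)).elim
    · exact hs.2.trans ih

theorem isUCQRewriting_of_halted (h : IsRun 𝒬 ℛ s) {n : ℕ} (hn : (s n).Halted) :
    IsUCQRewriting 𝒬 ℛ (s n).star := by
  refine ⟨h.isRewriting_star n, fun F hF => ?_⟩
  obtain ⟨m, hm⟩ := h.exists_factsEntail hF
  rw [← h.eq_of_halted hn (max m n) (le_max_right _ _)]
  exact hm _ (le_max_left _ _)

theorem exists_halted (h : IsRun 𝒬 ℛ s) (hrew : UCQRewritable 𝒬 ℛ) : ∃ n, (s n).Halted := by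
  obtain ⟨A, hA⟩ := hrew
  have hex : ∀ Q ∈ A, ∃ n, ∀ m, n ≤ m → FactsEntail Q ((s m).star : Set (CQ V)) :=
    fun Q hQ => h.exists_factsEntail (IsRewriting.kbEntails_of_mem hA.1 hQ)
  choose! N hN using hex
  -- At stage `A.sup N` every CQ of `A` is covered by `star`; the next iteration can add nothing.
  refine ⟨A.sup N + 1, ?_⟩
  rcases h.2 (A.sup N) with hs | hs
  · refine Finset.eq_empty_iff_forall_notMem.2 fun Q hQ => ?_
    have hkb := (hs.newlyProduced_of_mem_new hQ).kbEntails (h.isRewriting_star _)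
    have hent : Entails (A : Set (CQ V)) (s (A.sup N)).star :=
      entails_iff_factsEntail.2 fun P hP => hN P hP _ (Finset.le_sup hP)
    obtain ⟨P, hP, hom⟩ := factsEntail_iff.1 ((hA.2 Q hkb).trans hent)
    exact hs.not_homTo_of_mem_new hQ hP hom
  · rw [hs.2]
    exact hs.1

end IsRun

end DisjRewriting

theorem theorem4 {V : Vocabulary.{u, v}} (𝒬 : UCQ V)
    (ℛ : Finset (Rule V)) :
    -- the algorithm can be executed, and never gets stuck before halting
    ((∃ s, IsInitial 𝒬 s) ∧
      ∀ s₀ s, IsInitial 𝒬 s₀ →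
        Relation.ReflTransGen (Step ℛ) s₀ s → ¬ s.Halted →
          ∃ s', Step ℛ s s') ∧
    ∀ s : ℕ → State V, IsRun 𝒬 ℛ s →
      -- every intermediate result is sound
      (∀ n, IsRewriting 𝒬 ℛ ((s n).star : Set (CQ V))) ∧
      -- the CQs computed in the course of the execution form a sound and complete rewriting
      IsCompleteRewriting 𝒬 ℛ
        (⋃ n, ((s n).star : Set (CQ V))) ∧
      -- and nothing is lost by the removal of CQs
      (∀ F : CQ V, KBEntails F ℛ 𝒬 →
        ∃ n, ∀ m, n ≤ m →
          FactsEntail F ((s m).star : Set (CQ V))) ∧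
      -- if the algorithm halts, its output is a minimal UCQ-rewriting
      (∀ n, (s n).Halted →
        IsUCQRewriting 𝒬 ℛ (s n).star ∧ IsMinimal (s n).star) ∧
      -- it halts when a UCQ-rewriting exists
      (UCQRewritable 𝒬 ℛ →
        ∃ n, (s n).Halted ∧ IsUCQRewriting 𝒬 ℛ (s n).star ∧
          IsMinimal (s n).star) := by
  refine ⟨⟨exists_isInitial 𝒬, fun _ _ _ _ h => exists_step h⟩, fun s hs => ⟨hs.isRewriting_star,
    ⟨?_, fun F hF => ?_⟩, fun F hF => hs.exists_factsEntail hF,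
    fun n hn => ⟨hs.isUCQRewriting_of_halted hn, hs.isMinimal_star n⟩, fun hrew => ?_⟩⟩
  · refine IsRewriting.of_forall_mem fun Q hQ => ?_
    obtain ⟨n, hQ⟩ := Set.mem_iUnion.1 hQ
    exact IsRewriting.kbEntails_of_mem (hs.isRewriting_star n) hQ
  · obtain ⟨n, hn⟩ := hs.exists_factsEntail hF
    obtain ⟨Q, hQ, hom⟩ := factsEntail_iff.1 (hn n le_rfl)
    exact factsEntail_iff.2 ⟨Q, Set.mem_iUnion.2 ⟨n, hQ⟩, hom⟩
  · obtain ⟨n, hn⟩ := hs.exists_halted hrew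
    exact ⟨n, hn, hs.isUCQRewriting_of_halted hn, hs.isMinimal_star n⟩
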